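/- There is an absolute constant $C>0$ such that the following holds for every finite undirected graph $G=(V,E)$ with capacities $c:E\to[0,\infty)$ and every set $K\subseteq V$ of $k$ terminals, any two of which are joined by a path in $G$. One can fix, for every pair $a,b\in K$, a flow in $G$ that sends one unit from $a$ to $b$, such that for every demand $\vec d=(d_{a,b})_{a,b\in K}$ with $d_{a,b}\ge 0$, the congestion incurred by routing $\vec d$ obliviously (scaling the fixed unit flow of each pair $a,b$ by $d_{a,b}$) is at most $C\log k$ times $\mathrm{cong}_G(\vec d)$. Here a flow from $a$ to $b$ assigns nonnegative amounts to the simple paths from $a$ to $b$; the congestion of a multicommodity flow is the least $\lambda\in[0,\infty]$ such that the total flow on each edge $e$ is at most $\lambda\,c(e)$ (it is $\infty$ if and only if an edge of capacity $0$ carries positive flow); and $\mathrm{cong}_G(\vec d)$ is the minimum congestion of a multicommodity flow in $G$ that routes $\vec d$. (If $k\le 1$, both congestions are $0$.) This guarantee is optimal up to the constant: there is an absolute constant $C'>0$ such that for every $k\ge 2$ there are a finite connected graph $G$ with positive edge capacities and a set $K$ of $k$ of its vertices such that, for every choice of fixed unit flows for the pairs in $K$, some demand $\vec d$ on $K$ with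 $0<\mathrm{cong}_G(\vec d)<\infty$ incurs congestion at least $C'\log k\cdot\mathrm{cong}_G(\vec d)$ when it is routed obliviously. -/

import Mathlib

open scoped NNReal ENNReal

/-! Flows in a finite undirected graph `G` whose edges carry nonnegative capacities. Flows are
given by the amount of flow they send along each simple path. -/

namespace SteinerRouting

noncomputable section

/-- A demand on the terminal set `K`: the nonnegative amount to be sent from `a` to `b`, for each
pair of terminals. -/
abbrev Demand {V : Type*} (K : Finset V) : Type _ := K → K → ℝ≥0

/-- A multicommodity flow with end points in `K`: for each pair of terminals `a`, `b`, the
nonnegative amount of flow on each simple path from `a` to `b`. -/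
abbrev MultiFlow {V : Type*} (G : SimpleGraph V) (K : Finset V) : Type _ :=
  (a b : K) → G.Path (a : V) (b : V) → ℝ≥0

section
variable {V : Type*} [Fintype V] {G : SimpleGraph V} {K : Finset V}

open scoped Classical in
/-- The flow `x` routes the demand `d`: for each pair `a`, `b` it sends `d a b` units from `a`
to `b`. -/
def Routes (x : MultiFlow G K) (d : Demand K) : Prop :=
  ∀ a b : K, ∑ P : G.Path (a : V) (b : V), x a b P = d a b

open scoped Classical in
/-- The total flow on the edge `e`. -/
def load (x : MultiFlow G K) (e : G.edgeSet) : ℝ≥0 :=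
  ∑ a : K, ∑ b : K, ∑ P : G.Path (a : V) (b : V),
    if (e : Sym2 V) ∈ P.1.edges then x a b P else 0

/-- The congestion of the flow `x`: the least `C` in `[0, ∞]` such that on every edge `e` the total
flow is at most `C` times the capacity (in `ℝ≥0∞`, `0 / 0 = 0`, and `t / 0 = ∞` for `t > 0`). -/
def congestion (c : G.edgeSet → ℝ≥0) (x : MultiFlow G K) : ℝ≥0∞ :=
  ⨆ e : G.edgeSet, (load x e : ℝ≥0∞) / (c e : ℝ≥0∞)

/-- The optimal congestion with which the demand `d` can be routed in `G`; it is `∞` if `d` cannot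
be routed with finite congestion. -/
def optCongestion (c : G.edgeSet → ℝ≥0) (d : Demand K) : ℝ≥0∞ :=
  ⨅ (x : MultiFlow G K) (_ : Routes x d), congestion c x

variable (G K) in
/-- A Steiner oblivious routing scheme: a unit flow from `a` to `b` for each pair of terminals,
fixed in advance of the demand. -/
structure ObliviousScheme where
  flow : MultiFlow G K
  unit : Routes flow fun _ _ => 1

/-- The flow with which the scheme `S` serves the demand `d`: the unit flow of each pair, scaled by
the demand of the pair. -/
def ObliviousScheme.serve (S : ObliviousScheme G K) (d : Demand K) : MultiFlow G K :=
  fun a b P => d a b * S.flow a b P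

end

end

end SteinerRouting

/-! Upper bound. A load vector `L` is good for a scheme if the scheme loads each edge at most `t * L
e` whenever the demand can be routed with load at most `t * cap`. Good vectors, over all schemes,
form a convex set. If it missed the box below `4 * N * cap`, a separating functional would be a
system of edge lengths `l` under which every good vector is long. So it suffices to find, for each
`l > 0`, a good vector with `∑ l * L ≤ N * ∑ cap * l` and `N = O(log k)` (`exists_scheme_of_pos`).

For fixed `l`, take the random hierarchy of Calinescu–Karloff–Rabani and Fakcharoenphol–Rao–Talwar.
With one radius `β` and one ranking of the terminals, each vertex goes, at scale `s * 2 ^ j`, to the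
first terminal within `s * 2 ^ j * β`. A terminal can separate the ends of an edge only if the
radius falls between its distances to them, and only if it precedes all terminals nearer to the
edge. The first event has total cost at most the length of the edge over all scales; the second has
the inverse distance rank as probability. The sum over terminals is harmonic (`exists_assignment`).
Each pair is routed through its centers, up to the level where the two cells coincide. Traffic that
leaves a cell is bounded by the cut around it, whatever the demand
(`exists_scheme_loadsAtMost_reserve`).

Lower bound. In the diamond graph each edge of a 4-cycle is repeatedly replaced by a 4-cycle. Pick
an edge at random, and at each scale `m` send `2 ^ m` units between the two opposite middles of the
diamond containing it. Routing always through the half that avoids the edge gives edge-disjoint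
walks, hence congestion at most 1. A scheme fixed in advance does not know the edge: a tent function
shows that each scale adds at least 1/2 to its expected load (`exists_costly_demand`). -/

namespace SteinerRouting

noncomputable section

/-! ### Cuts, loads and congestion. -/

section Flows
variable {V : Type*} {G : SimpleGraph V} {K : Finset V}

/-- The edge `e` has one end in `X` and the other end outside of `X`. -/
def Crosses (X : Set V) (e : Sym2 V) : Prop := ∃ u ∈ e, ∃ v ∈ e, u ∈ X ∧ v ∉ X

theorem crosses_mk {X : Set V} {u v : V} : Crosses X s(u, v) ↔ ¬(u ∈ X ↔ v ∈ X) := by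
  simp only [Crosses, Sym2.mem_iff]
  constructor
  · rintro ⟨a, rfl | rfl, b, rfl | rfl, h⟩ <;> tauto
  · intro h
    by_cases hu : u ∈ X
    · exact ⟨u, .inl rfl, v, .inr rfl, hu, by tauto⟩
    · exact ⟨v, .inr rfl, u, .inl rfl, by tauto, hu⟩

theorem exists_crosses_of_walk {X : Set V} {u v : V} (p : G.Walk u v) (h : ¬(u ∈ X ↔ v ∈ X)) :
    ∃ e ∈ p.edges, Crosses X e := by
  have key : ∀ {u v : V} (p : G.Walk u v), u ∈ X → v ∉ X → ∃ e ∈ p.edges, Crosses X e := by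
    intro u v p hu hv
    obtain ⟨d, hd, h1, h2⟩ := p.exists_boundary_dart X hu hv
    exact ⟨d.edge, List.mem_map_of_mem hd, d.fst, by simp [SimpleGraph.Dart.edge],
      d.snd, by simp [SimpleGraph.Dart.edge], h1, h2⟩
  by_cases hu : u ∈ X
  · exact key p hu (by tauto)
  · obtain ⟨e, he, hc⟩ := key p.reverse (by tauto) hu
    exact ⟨e, by simpa using he, hc⟩

variable [Fintype V]

open scoped Classical in
/-- The amount of flow from `a` to `b` that uses the edge `e`. -/
def pairLoad (x : MultiFlow G K) (a b : K) (e : G.edgeSet) : ℝ≥0 :=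
  ∑ P : G.Path (a : V) (b : V), if (e : Sym2 V) ∈ P.1.edges then x a b P else 0

theorem load_eq_sum_pairLoad (x : MultiFlow G K) (e : G.edgeSet) :
    load x e = ∑ a : K, ∑ b : K, pairLoad x a b e := rfl

theorem load_serve (S : ObliviousScheme G K) (d : Demand K) (e : G.edgeSet) :
    load (S.serve d) e = ∑ a : K, ∑ b : K, d a b * pairLoad S.flow a b e := by
  simp only [load, pairLoad, ObliviousScheme.serve, Finset.mul_sum, mul_ite, mul_zero]

open scoped Classical in
/-- The scheme that sends the unit flow of each pair along a single walk, freed of its cycles. -/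
def ObliviousScheme.ofWalks (w : ∀ a b : K, G.Walk (a : V) (b : V)) : ObliviousScheme G K where
  flow a b P := if P = (w a b).toPath then 1 else 0
  unit a b := by simp

open scoped Classical in
theorem load_ofWalks_serve_le (w : ∀ a b : K, G.Walk (a : V) (b : V)) (d : Demand K)
    (e : G.edgeSet) :
    load ((ObliviousScheme.ofWalks w).serve d) e ≤
      ∑ a : K, ∑ b : K, if (e : Sym2 V) ∈ (w a b).edges then d a b else 0 := by
  rw [load_serve]
  refine Finset.sum_le_sum fun a _ => Finset.sum_le_sum fun b _ => ?_
  have h : pairLoad (ObliviousScheme.ofWalks w).flow a b e =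
      if (e : Sym2 V) ∈ ((w a b).toPath : G.Walk (a : V) (b : V)).edges then 1 else 0 := by
    simp only [pairLoad, ObliviousScheme.ofWalks, ← ite_and]
    rw [Finset.sum_eq_single (w a b).toPath] <;> simp +contextual
  rw [h]
  by_cases he : (e : Sym2 V) ∈ ((w a b).toPath : G.Walk (a : V) (b : V)).edges
  · have : (e : Sym2 V) ∈ (w a b).edges := SimpleGraph.Walk.edges_bypass_subset_edges _ he
    simp [he, this]
  · simp [he]

open scoped Classical in
/-- The demand across a cut is at most the load of the cut. -/
theorem sum_demand_le_sum_load {x : MultiFlow G K} {d : Demand K} (hx : Routes x d) (X : Set V) :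
    (∑ a : K, ∑ b : K, if ¬((a : V) ∈ X ↔ (b : V) ∈ X) then d a b else 0) ≤
      ∑ e : G.edgeSet, if Crosses X e then load x e else 0 := by
  have h1 : (∑ e : G.edgeSet, if Crosses X e then load x e else 0) =
      ∑ a : K, ∑ b : K, ∑ P : G.Path (a : V) (b : V), ∑ e : G.edgeSet,
        if Crosses X e ∧ (e : Sym2 V) ∈ P.1.edges then x a b P else 0 := by
    simp only [ite_and, load]
    simp_rw [← Finset.sum_filter (fun e : G.edgeSet => Crosses X e)]
    rw [Finset.sum_comm]
    refine Finset.sum_congr rfl fun a _ => ?_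
    rw [Finset.sum_comm]
    refine Finset.sum_congr rfl fun b _ => ?_
    rw [Finset.sum_comm]
  rw [h1]
  refine Finset.sum_le_sum fun a _ => Finset.sum_le_sum fun b _ => ?_
  by_cases h : ¬((a : V) ∈ X ↔ (b : V) ∈ X)
  · rw [if_pos h, ← hx a b]
    refine Finset.sum_le_sum fun P _ => ?_
    obtain ⟨e, he, hc⟩ := exists_crosses_of_walk P.1 h
    have := Finset.single_le_sum (f := fun e : G.edgeSet =>
      if Crosses X e ∧ (e : Sym2 V) ∈ P.1.edges then x a b P else 0)
      (fun _ _ => bot_le) (Finset.mem_univ ⟨e, P.1.edges_subset_edgeSet he⟩)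
    simpa [he, hc] using this
  · rw [if_neg h]
    exact bot_le

theorem load_le_of_congestion_le {c : G.edgeSet → ℝ≥0} {x : MultiFlow G K} {t : ℝ≥0}
    (h : congestion c x ≤ t) (e : G.edgeSet) : load x e ≤ t * c e := by
  have h1 : (load x e : ℝ≥0∞) / c e ≤ t := (le_iSup_iff.2 fun _ hb => hb e).trans h
  rw [ENNReal.div_le_iff_le_mul (.inr ENNReal.coe_ne_top) (.inl ENNReal.coe_ne_top)] at h1
  exact_mod_cast h1

theorem congestion_le_of_load_le {c : G.edgeSet → ℝ≥0} {x : MultiFlow G K} {t : ℝ≥0}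
    (h : ∀ e, load x e ≤ t * c e) : congestion c x ≤ t := by
  refine iSup_le fun e => ENNReal.div_le_of_le_mul ?_
  exact_mod_cast h e

end Flows

/-! ### The random assignment of points to centers, derandomized by averaging. -/

section RandomAssignment

/-- When `s` is listed by increasing `f`, the `i`-th element has at least `i` elements below or
level with it; ties only shrink the terms. -/
theorem sum_inv_card_le_harmonic {α : Type*} [DecidableEq α] (f : α → ℝ) (s : Finset α) :
    ∑ w ∈ s, ((s.filter fun w' => f w' ≤ f w).card : ℝ)⁻¹ ≤ (harmonic s.card : ℝ) := by
  induction s using Finset.induction_on_max_value f with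
  | empty => simp
  | insert a s ha hmax ih =>
    rw [Finset.sum_insert ha, Finset.card_insert_of_notMem ha, harmonic_succ]
    have h1 : ((insert a s).filter fun w' => f w' ≤ f a) = insert a s := by
      refine Finset.filter_true_of_mem fun w hw => ?_
      rcases Finset.mem_insert.1 hw with rfl | hw
      exacts [le_rfl, hmax w hw]
    rw [h1, Finset.card_insert_of_notMem ha]
    push_cast
    have h2 : ∑ w ∈ s, (((insert a s).filter fun w' => f w' ≤ f w).card : ℝ)⁻¹ ≤
        ∑ w ∈ s, ((s.filter fun w' => f w' ≤ f w).card : ℝ)⁻¹ := by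
      refine Finset.sum_le_sum fun w hw => ?_
      have hpos : 0 < (s.filter fun w' => f w' ≤ f w).card :=
        Finset.card_pos.2 ⟨w, by simp [hw]⟩
      have hle : (s.filter fun w' => f w' ≤ f w).card ≤
          ((insert a s).filter fun w' => f w' ≤ f w).card :=
        Finset.card_le_card (Finset.filter_subset_filter _ (Finset.subset_insert a s))
      gcongr
    linarith

variable {K : Type*}

open scoped Classical in
/-- The member of `B` that is ranked first by `σ`. -/
def firstMember (σ : K → ℕ) (B : Finset K) : Option K :=
  if h : B.Nonempty then some (B.exists_min_image σ h).choose else none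

theorem firstMember_eq_none {σ : K → ℕ} {B : Finset K} : firstMember σ B = none ↔ B = ∅ := by
  unfold firstMember
  split_ifs with h
  · simp [h.ne_empty]
  · simpa using h

theorem firstMember_eq_some {σ : K → ℕ} (hσ : Function.Injective σ) {B : Finset K} {w : K} :
    firstMember σ B = some w ↔ w ∈ B ∧ ∀ w' ∈ B, σ w ≤ σ w' := by
  unfold firstMember
  split_ifs with h
  · have hs := (B.exists_min_image σ h).choose_spec
    simp only [Option.some.injEq]
    constructor
    · rintro rfl
      exact hs
    · rintro ⟨h1, h2⟩
      exact hσ (le_antisymm (hs.2 _ h1) (h2 _ hs.1))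
  · simp [Finset.not_nonempty_iff_eq_empty.1 h]

variable [DecidableEq K]

/-- The first element of the union would be the first of both sets if it belonged to both. -/
theorem exists_first_of_firstMember_ne {σ : K → ℕ} (hσ : Function.Injective σ) {A B : Finset K}
    (h : firstMember σ A ≠ firstMember σ B) :
    ∃ w ∈ A ∪ B, (∀ w' ∈ A ∪ B, σ w ≤ σ w') ∧ ¬(w ∈ A ∧ w ∈ B) := by
  have hne : (A ∪ B).Nonempty := by
    by_contra hne
    rw [Finset.not_nonempty_iff_eq_empty, Finset.union_eq_empty] at hne
    exact h (by rw [hne.1, hne.2])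
  obtain ⟨w, hw, hmin⟩ := (A ∪ B).exists_min_image σ hne
  refine ⟨w, hw, hmin, fun hAB => h ?_⟩
  rw [(firstMember_eq_some hσ).2 ⟨hAB.1, fun w' hw' => hmin w' (Finset.mem_union_left _ hw')⟩,
    (firstMember_eq_some hσ).2 ⟨hAB.2, fun w' hw' => hmin w' (Finset.mem_union_right _ hw')⟩]

variable [Fintype K]

/-- In a random ranking, each element of `B` is first with probability at most `1 / |B|`. -/
theorem card_mul_card_first_le {n : ℕ} (B : Finset K) {w : K} (hw : w ∈ B) :
    B.card * (Finset.univ.filter fun σ : K ≃ Fin n => ∀ w' ∈ B, σ w ≤ σ w').card ≤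
      Fintype.card (K ≃ Fin n) := by
  set N : K → Finset (K ≃ Fin n) := fun w => Finset.univ.filter fun σ => ∀ w' ∈ B, σ w ≤ σ w'
  have hN : ∀ w₁ ∈ B, (N w).card ≤ (N w₁).card := by
    intro w₁ h₁
    -- Transposing `w` and `w₁`, which permutes `B`, turns rankings with `w` first into rankings
    -- with `w₁` first.
    refine Finset.card_le_card_of_injOn (fun σ => (Equiv.swap w w₁).trans σ) ?_ ?_
    · intro σ hσ
      simp only [N, Finset.coe_filter, Finset.mem_univ, true_and, Set.mem_ofPred_eq] at hσ ⊢
      intro w' hw'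
      simp only [Equiv.trans_apply, Equiv.swap_apply_right]
      refine hσ _ ?_
      rw [Equiv.swap_apply_def]
      split_ifs <;> assumption
    · intro σ _ τ _ h
      refine Equiv.ext fun x => ?_
      have := congrArg (fun ρ : K ≃ Fin n => ρ (Equiv.swap w w₁ x)) h
      simpa using this
  have hdisj : (B : Set K).PairwiseDisjoint N := by
    intro a ha b hb hab
    refine Finset.disjoint_left.2 fun σ h1 h2 => hab ?_
    simp only [N, Finset.mem_filter, Finset.mem_univ, true_and] at h1 h2
    exact σ.injective (le_antisymm (h1 b hb) (h2 a ha))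
  calc B.card * (N w).card = ∑ _w₁ ∈ B, (N w).card := by simp
    _ ≤ ∑ w₁ ∈ B, (N w₁).card := Finset.sum_le_sum hN
    _ = (B.biUnion N).card := (Finset.card_biUnion hdisj).symm
    _ ≤ Fintype.card (K ≃ Fin n) := Finset.card_le_univ _

open scoped Classical in
-- For `β` uniform in `[1, 2)` the right side is the mean of the left: each term is the length of
-- `[l, r) ∩ [1, 2)`.
theorem exists_radius_sum_le {τ : Type*} [Fintype τ] (q l r : τ → ℝ) :
    ∃ β ∈ Set.Ico (1 : ℝ) 2, ∑ t, q t * (if l t ≤ β ∧ β < r t then 1 else 0) ≤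
      ∑ t, q t * max 0 (min 2 (r t) - max 1 (l t)) := by
  set f : ℝ → ℝ := fun β => ∑ t, q t * (if l t ≤ β ∧ β < r t then 1 else 0) with hf
  have hfe : f = fun β => ∑ t, q t * (Set.Ico (l t) (r t)).indicator 1 β := by
    ext β
    simp [f, Set.indicator_apply]
  have hi : ∀ t, MeasureTheory.IntegrableOn
      (fun β => q t * (Set.Ico (l t) (r t)).indicator (1 : ℝ → ℝ) β) (Set.Ico 1 2) := by
    intro t
    refine MeasureTheory.Integrable.const_mul ?_ _
    refine MeasureTheory.Integrable.indicator ?_ measurableSet_Ico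
    exact MeasureTheory.integrableOn_const (by simp)
  have hint : MeasureTheory.IntegrableOn f (Set.Ico 1 2) := by
    rw [hfe]
    exact MeasureTheory.integrable_finsetSum _ fun t _ => hi t
  obtain ⟨β, hβ, hle⟩ := MeasureTheory.exists_le_setAverage (μ := MeasureTheory.volume)
    (by simp) (by simp) hint
  refine ⟨β, hβ, hle.trans_eq ?_⟩
  rw [MeasureTheory.setAverage_eq, hfe, MeasureTheory.integral_finsetSum _ fun t _ => hi t]
  have hvol : MeasureTheory.volume.real (Set.Ico (1 : ℝ) 2) = 1 := by
    rw [Real.volume_real_Ico]; norm_num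
  rw [hvol, inv_one, one_smul]
  refine Finset.sum_congr rfl fun t _ => ?_
  rw [MeasureTheory.integral_const_mul, MeasureTheory.integral_indicator measurableSet_Ico,
    MeasureTheory.Measure.restrict_restrict measurableSet_Ico, Set.Ico_inter_Ico]
  simp only [Pi.one_apply, MeasureTheory.integral_const, smul_eq_mul, mul_one]
  rw [MeasureTheory.measureReal_restrict_apply MeasurableSet.univ, Set.univ_inter,
    Real.volume_real_Ico, max_comm, min_comm, max_comm (l t)]

/-- The term at scale `x = s * 2 ^ j` is the length of `[m, m') ∩ [x, 2 * x)`, and these dyadic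
intervals are disjoint. The clamp `φ` makes the sum telescope. -/
theorem sum_scaled_overlap_le {m m' s : ℝ} (hm : m ≤ m') (hs : 0 < s) (M : ℕ) :
    ∑ j ∈ Finset.range M,
      s * 2 ^ j * max 0 (min 2 (m' / (s * 2 ^ j)) - max 1 (m / (s * 2 ^ j))) ≤ m' - m := by
  set φ : ℝ → ℝ := fun y => max m (min y m') with hφ
  have hstep : ∀ x : ℝ, 0 < x →
      x * max 0 (min 2 (m' / x) - max 1 (m / x)) ≤ φ (2 * x) - φ x := by
    intro x hx
    have h1 : x * max 0 (min 2 (m' / x) - max 1 (m / x)) =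
        max 0 (min (2 * x) m' - max x m) := by
      rw [mul_max_of_nonneg _ _ hx.le, mul_sub, mul_min_of_nonneg _ _ hx.le,
        mul_max_of_nonneg _ _ hx.le, mul_div_cancel₀ _ hx.ne', mul_div_cancel₀ _ hx.ne']
      ring_nf
    rw [h1]
    simp only [hφ]
    rcases le_total (2 * x) m' with h2 | h2 <;> rcases le_total x m' with h3 | h3 <;>
      rcases le_total x m with h4 | h4 <;> rcases le_total (2 * x) m with h5 | h5 <;>
      simp only [min_eq_left, min_eq_right, max_eq_left, max_eq_right, h2, h3, h4, h5, hm] <;>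
      refine max_le ?_ ?_ <;> linarith
  calc _ ≤ ∑ j ∈ Finset.range M, (φ (s * 2 ^ (j + 1)) - φ (s * 2 ^ j)) := by
        refine Finset.sum_le_sum fun j _ => (hstep _ (by positivity)).trans_eq ?_
        ring_nf
    _ = φ (s * 2 ^ M) - φ (s * 2 ^ 0) := Finset.sum_range_sub (fun j => φ (s * 2 ^ j)) M
    _ ≤ m' - m := by
        have h1 : φ (s * 2 ^ M) ≤ m' := max_le hm (min_le_right _ _)
        have h2 : m ≤ φ (s * 2 ^ 0) := le_max_left _ _
        linarith

open scoped Classical in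
/-- Radii in geometric progression and a ranking of the centers such that, when each point is
assigned to the first center within each radius, edges are cut at a logarithmic cost. -/
theorem exists_assignment {V ι : Type*} [Fintype ι] (D : V → K → ℝ) (u v : ι → V) (c l : ι → ℝ)
    (hc : ∀ e, 0 ≤ c e) (hl : ∀ e w, |D (u e) w - D (v e) w| ≤ l e) {s : ℝ} (hs : 0 < s) (M : ℕ) :
    ∃ β ∈ Set.Ico (1 : ℝ) 2, ∃ σ : K → ℕ, Function.Injective σ ∧
      ∑ e, c e * ∑ j ∈ Finset.range M, s * 2 ^ j *
        (if firstMember σ (Finset.univ.filter fun w => D (u e) w ≤ s * 2 ^ j * β) ≠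
          firstMember σ (Finset.univ.filter fun w => D (v e) w ≤ s * 2 ^ j * β) then 1 else 0) ≤
      (harmonic (Fintype.card K) : ℝ) * ∑ e, c e * l e := by
  set lo : ι → K → ℝ := fun e w => min (D (u e) w) (D (v e) w) with hlo
  set hi : ι → K → ℝ := fun e w => max (D (u e) w) (D (v e) w) with hhi
  -- The terminals at least as near to the edge as `w`: only if `w` precedes all of them can it be
  -- the first to claim exactly one end.
  set B : ι → K → Finset K := fun e w => Finset.univ.filter fun w' => lo e w' ≤ lo e w with hB
  have hBpos : ∀ e w, (0 : ℝ) < (B e w).card := fun e w => by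
    exact_mod_cast Finset.card_pos.2 ⟨w, by simp [B]⟩
  have hwidth : ∀ e w, hi e w - lo e w ≤ l e := fun e w => by
    rw [hlo, hhi]
    simp only [max_sub_min_eq_abs]
    rw [abs_sub_comm]
    exact hl e w
  -- The radius is fixed before the ranking, so the inverse of `|B e w|` stands in for the
  -- probability that `w` comes first in `B e w`.
  obtain ⟨β, hβ, hle⟩ := exists_radius_sum_le
    (fun t : (ι × K) × Fin M => c t.1.1 * (((B t.1.1 t.1.2).card : ℝ)⁻¹ * (s * 2 ^ (t.2 : ℕ))))
    (fun t => lo t.1.1 t.1.2 / (s * 2 ^ (t.2 : ℕ))) (fun t => hi t.1.1 t.1.2 / (s * 2 ^ (t.2 : ℕ)))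
  set T : ι → K → ℝ := fun e w => ∑ j ∈ Finset.range M, s * 2 ^ j *
    (if lo e w ≤ s * 2 ^ j * β ∧ s * 2 ^ j * β < hi e w then 1 else 0) with hT
  have hT0 : ∀ e w, 0 ≤ T e w := fun e w => Finset.sum_nonneg fun j _ => by positivity
  have hrad : ∑ e, c e * ∑ w, ((B e w).card : ℝ)⁻¹ * T e w ≤
      (harmonic (Fintype.card K) : ℝ) * ∑ e, c e * l e := by
    have h1 : ∑ e, c e * ∑ w, ((B e w).card : ℝ)⁻¹ * T e w ≤ ∑ e, c e * ∑ w, ((B e w).card : ℝ)⁻¹ *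
        ∑ j ∈ Finset.range M, s * 2 ^ j *
          max 0 (min 2 (hi e w / (s * 2 ^ j)) - max 1 (lo e w / (s * 2 ^ j))) := by
      convert hle using 1
      · rw [Fintype.sum_prod_type, Fintype.sum_prod_type]
        refine Finset.sum_congr rfl fun e _ => ?_
        rw [Finset.mul_sum]
        refine Finset.sum_congr rfl fun w _ => ?_
        rw [hT, Finset.mul_sum, Finset.mul_sum, Finset.sum_range]
        refine Finset.sum_congr rfl fun j _ => ?_
        have hp : 0 < s * 2 ^ (j : ℕ) := by positivity
        simp only [div_le_iff₀ hp, lt_div_iff₀ hp, mul_comm β]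
        ring
      · rw [Fintype.sum_prod_type, Fintype.sum_prod_type]
        refine Finset.sum_congr rfl fun e _ => ?_
        rw [Finset.mul_sum]
        refine Finset.sum_congr rfl fun w _ => ?_
        rw [Finset.mul_sum, Finset.mul_sum, Finset.sum_range]
        refine Finset.sum_congr rfl fun j _ => ?_
        ring
    refine h1.trans ?_
    rw [Finset.mul_sum]
    refine Finset.sum_le_sum fun e _ => ?_
    have h2 : ∑ w, ((B e w).card : ℝ)⁻¹ * ∑ j ∈ Finset.range M, s * 2 ^ j *
          max 0 (min 2 (hi e w / (s * 2 ^ j)) - max 1 (lo e w / (s * 2 ^ j))) ≤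
        ∑ w, ((B e w).card : ℝ)⁻¹ * l e := by
      refine Finset.sum_le_sum fun w _ => mul_le_mul_of_nonneg_left ?_ (by positivity)
      exact (sum_scaled_overlap_le min_le_max hs M).trans (hwidth e w)
    rcases isEmpty_or_nonempty K with hK | ⟨⟨w₀⟩⟩
    · simp
    have hl0 : 0 ≤ l e := (abs_nonneg _).trans (hl e w₀)
    have h3 := sum_inv_card_le_harmonic (lo e) (Finset.univ : Finset K)
    calc _ ≤ c e * ∑ w, ((B e w).card : ℝ)⁻¹ * l e := mul_le_mul_of_nonneg_left h2 (hc e)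
      _ = (c e * l e) * ∑ w, ((B e w).card : ℝ)⁻¹ := by rw [← Finset.sum_mul]; ring
      _ ≤ (c e * l e) * (harmonic (Fintype.card K) : ℝ) :=
          mul_le_mul_of_nonneg_left h3 (mul_nonneg (hc e) hl0)
      _ = _ := mul_comm _ _
  set n := Fintype.card K
  have : Nonempty (K ≃ Fin n) := ⟨Fintype.equivFin K⟩
  -- Some ranking does no worse than the mean over all rankings.
  obtain ⟨σ, -, hσ⟩ := Finset.exists_le_of_sum_le
    (f := fun σ : K ≃ Fin n =>
      ∑ e, c e * ∑ w, (if ∀ w' ∈ B e w, σ w ≤ σ w' then 1 else 0) * T e w)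
    (g := fun _ => ∑ e, c e * ∑ w, ((B e w).card : ℝ)⁻¹ * T e w)
    (Finset.univ_nonempty (α := K ≃ Fin n)) (by
      rw [Finset.sum_comm]
      simp only [← Finset.mul_sum]
      rw [Finset.sum_const, nsmul_eq_mul, Finset.mul_sum]
      refine Finset.sum_le_sum fun e _ => ?_
      rw [mul_left_comm]
      refine mul_le_mul_of_nonneg_left ?_ (hc e)
      rw [Finset.sum_comm, Finset.mul_sum]
      refine Finset.sum_le_sum fun w _ => ?_
      rw [← Finset.sum_mul, ← mul_assoc]
      refine mul_le_mul_of_nonneg_right ?_ (hT0 e w)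
      have := card_mul_card_first_le (n := n) (B e w) (w := w) (by simp [B])
      rw [Finset.sum_boole, ← div_eq_mul_inv, le_div_iff₀ (hBpos e w), mul_comm]
      exact_mod_cast this)
  refine ⟨β, hβ, fun w => σ w, fun a b h => σ.injective (Fin.ext h), ?_⟩
  refine le_trans ?_ (hσ.trans hrad)
  refine Finset.sum_le_sum fun e _ => mul_le_mul_of_nonneg_left ?_ (hc e)
  simp only [hT, Finset.mul_sum]
  rw [Finset.sum_comm]
  refine Finset.sum_le_sum fun j _ => ?_
  split_ifs with h
  -- The first terminal `w` in either ball lies in only one of them, so the radius is between its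
  -- two distances. All of `B e w` lies in the union of the balls, hence ranks no earlier.
  · obtain ⟨w, hw, hmin, hAB⟩ := exists_first_of_firstMember_ne
      (fun a b h => σ.injective (Fin.ext h)) h
    simp only [Finset.mem_union, Finset.mem_filter, Finset.mem_univ, true_and] at hw hmin hAB
    have hlo' : lo e w ≤ s * 2 ^ j * β := min_le_iff.2 hw
    have hhi' : s * 2 ^ j * β < hi e w := by
      rw [lt_max_iff]
      by_contra hcon
      push Not at hcon
      exact hAB hcon
    have hfirst : ∀ w' ∈ B e w, σ w ≤ σ w' := by
      intro w' hw'
      have h1 : lo e w' ≤ lo e w := by simpa [B] using hw'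
      exact hmin w' (min_le_iff.1 (h1.trans hlo'))
    refine le_trans ?_ (Finset.single_le_sum (fun w _ => by positivity) (Finset.mem_univ w))
    rw [if_pos hfirst, if_pos ⟨hlo', hhi'⟩, one_mul]
  · rw [mul_zero]
    exact Finset.sum_nonneg fun w _ => by positivity

end RandomAssignment

/-! ### Shortest-path distances for edge lengths. -/

section Distance
variable {V : Type*} {G : SimpleGraph V}

/-- The length of a walk with respect to edge lengths `l`. -/
def walkLength (l : Sym2 V → ℝ) {u v : V} (p : G.Walk u v) : ℝ := (p.edges.map l).sum

variable (G) in
/-- The length of a shortest path. -/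
def pathDist (l : Sym2 V → ℝ) (u v : V) : ℝ := ⨅ P : G.Path u v, walkLength l P.1

variable {l : Sym2 V → ℝ}

theorem walkLength_nonneg (hl : ∀ e, 0 ≤ l e) {u v : V} (p : G.Walk u v) : 0 ≤ walkLength l p :=
  List.sum_nonneg fun x hx => by
    obtain ⟨e, -, rfl⟩ := List.mem_map.1 hx
    exact hl e

open scoped Classical in
theorem pathDist_le (hl : ∀ e, 0 ≤ l e) {u v : V} (p : G.Walk u v) :
    pathDist G l u v ≤ walkLength l p := by
  refine (ciInf_le ⟨0, ?_⟩ p.toPath).trans ?_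
  · rintro _ ⟨P, rfl⟩
    exact walkLength_nonneg hl _
  · refine List.Sublist.sum_le_sum ((SimpleGraph.Walk.edges_bypass_sublist_edges p).map l) ?_
    intro x hx
    obtain ⟨e, -, rfl⟩ := List.mem_map.1 hx
    exact hl e

theorem pathDist_self (hl : ∀ e, 0 ≤ l e) (u : V) : pathDist G l u u ≤ 0 :=
  (pathDist_le hl (SimpleGraph.Walk.nil : G.Walk u u)).trans_eq (by simp [walkLength])

theorem exists_walkLength_eq [Finite V] {u v : V} (h : G.Reachable u v) :
    ∃ p : G.Walk u v, walkLength l p = pathDist G l u v := by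
  classical
  have := Fintype.ofFinite V
  have : Nonempty (G.Path u v) := h.elim fun p => ⟨p.toPath⟩
  obtain ⟨P, hP⟩ := exists_eq_ciInf_of_finite (f := fun P : G.Path u v => walkLength l P.1)
  exact ⟨P.1, hP⟩

theorem pathDist_triangle [Finite V] (hl : ∀ e, 0 ≤ l e) {u v w : V}
    (h₁ : G.Reachable u v) (h₂ : G.Reachable v w) :
    pathDist G l u w ≤ pathDist G l u v + pathDist G l v w := by
  obtain ⟨p, hp⟩ := exists_walkLength_eq (l := l) h₁
  obtain ⟨q, hq⟩ := exists_walkLength_eq (l := l) h₂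
  rw [← hp, ← hq]
  refine (pathDist_le hl (p.append q)).trans_eq ?_
  simp [walkLength, SimpleGraph.Walk.edges_append]

theorem pathDist_comm [Finite V] (hl : ∀ e, 0 ≤ l e) (u v : V) :
    pathDist G l u v = pathDist G l v u := by
  have key : ∀ u v, G.Reachable u v → pathDist G l v u ≤ pathDist G l u v := by
    intro u v h
    obtain ⟨p, hp⟩ := exists_walkLength_eq (l := l) h
    rw [← hp]
    refine (pathDist_le hl p.reverse).trans_eq ?_
    simp [walkLength]
  by_cases h : G.Reachable u v
  · exact le_antisymm (key _ _ h.symm) (key _ _ h)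
  · have h1 : IsEmpty (G.Path u v) := ⟨fun P => h ⟨P.1⟩⟩
    have h2 : IsEmpty (G.Path v u) := ⟨fun P => h ⟨P.1.reverse⟩⟩
    simp [pathDist]

/-- Also true for unreachable pairs, whose distance is `0` by convention. -/
theorem abs_pathDist_sub_le [Finite V] (hl : ∀ e, 0 ≤ l e) {u v : V} (h : G.Adj u v) (w : V) :
    |pathDist G l u w - pathDist G l v w| ≤ l s(u, v) := by
  have key : ∀ {u v}, G.Adj u v → pathDist G l u w ≤ l s(u, v) + pathDist G l v w := by
    intro u v h
    by_cases hw : G.Reachable v w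
    · obtain ⟨p, hp⟩ := exists_walkLength_eq (l := l) hw
      rw [← hp]
      refine (pathDist_le hl (p.cons h)).trans_eq ?_
      simp [walkLength]
    · have h1 : IsEmpty (G.Path v w) := ⟨fun P => hw ⟨P.1⟩⟩
      have h2 : IsEmpty (G.Path u w) := ⟨fun P => hw ⟨P.1.cons h.symm⟩⟩
      simp [pathDist, hl]
  have h1 := key h
  have h2 := key h.symm
  rw [Sym2.eq_swap] at h2
  rw [abs_le]
  constructor <;> linarith

theorem le_pathDist [Finite V] (hl : ∀ e, 0 ≤ l e) {ε : ℝ} (hε : ∀ e, ε ≤ l e) {u v : V}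
    (huv : u ≠ v) (h : G.Reachable u v) : ε ≤ pathDist G l u v := by
  obtain ⟨p, hp⟩ := exists_walkLength_eq (l := l) h
  rw [← hp]
  cases p with
  | nil => exact absurd rfl huv
  | @cons _ x _ hadj q =>
    have := walkLength_nonneg hl q
    simp only [walkLength, SimpleGraph.Walk.edges_cons, List.map_cons, List.sum_cons] at this ⊢
    linarith [hε s(u, x)]

open scoped Classical in
theorem sum_mem_edges_le [Fintype V] (hl : ∀ e, 0 ≤ l e) {u v : V} (p : G.Walk u v) :
    ∑ e : G.edgeSet, (if (e : Sym2 V) ∈ p.edges then l e else 0) ≤ walkLength l p := by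
  have h1 : ∑ e : G.edgeSet, (if (e : Sym2 V) ∈ p.edges then l e else 0) ≤
      ∑ e ∈ p.edges.toFinset, l e := by
    rw [← Finset.sum_filter, ← Finset.sum_image (f := l) (g := fun e : G.edgeSet => (e : Sym2 V))
      (Subtype.val_injective.injOn)]
    refine Finset.sum_le_sum_of_subset_of_nonneg ?_ fun e _ _ => hl e
    intro e he
    obtain ⟨e', he', rfl⟩ := Finset.mem_image.1 he
    simpa using he'
  refine h1.trans ?_
  rw [walkLength, Finset.sum, List.toFinset_val, Multiset.map_coe, Multiset.sum_coe]
  refine List.Sublist.sum_le_sum ((List.dedup_sublist _).map l) ?_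
  intro x hx
  obtain ⟨e, -, rfl⟩ := List.mem_map.1 hx
  exact hl e

end Distance

/-! ### Routing through the hierarchy of centers. -/

section Hierarchy
variable {V : Type*} {G : SimpleGraph V} {K : Finset V}

/-- The label of `v` at level `i`: the list of its assignments at the levels from `i` to `M`. -/
def levelLabel (g : ℕ → V → Option K) (M i : ℕ) (v : V) : ℕ → Option K :=
  fun j => if i ≤ j ∧ j ≤ M then g j v else none

theorem exists_walk_climb {c : ℕ → K → K} (h0 : ∀ a, c 0 a = a)
    (seg : ∀ a b : K, G.Walk (a : V) (b : V)) (m : ℕ) (a : K) :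
    ∃ w : G.Walk (a : V) (c m a), ∀ e ∈ w.edges,
      ∃ i < m, e ∈ (seg (c i a) (c (i + 1) a)).edges := by
  induction m with
  | zero =>
    rw [h0]
    exact ⟨SimpleGraph.Walk.nil, by simp⟩
  | succ m ih =>
    obtain ⟨w, hw⟩ := ih
    refine ⟨w.append (seg _ _), fun e he => ?_⟩
    rw [SimpleGraph.Walk.edges_append, List.mem_append] at he
    rcases he with he | he
    · obtain ⟨i, hi, h⟩ := hw e he
      exact ⟨i, hi.trans (Nat.lt_succ_self m), h⟩
    · exact ⟨m, Nat.lt_succ_self m, he⟩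

/-- Climb from `a` and from `b` to the first level where their labels agree. -/
theorem exists_walk_through_centers {g : ℕ → V → Option K} {c : ℕ → K → K} {M : ℕ}
    (hg : ∀ j ≤ M, ∀ a : K, g j a = some (c j a)) (h0 : ∀ a, c 0 a = a)
    (hM : ∀ a b, c M a = c M b) (seg : ∀ a b : K, G.Walk (a : V) (b : V)) (a b : K) :
    ∃ w : G.Walk (a : V) (b : V), ∀ e ∈ w.edges,
      ∃ i < M, levelLabel g M i a ≠ levelLabel g M i b ∧
        (e ∈ (seg (c i a) (c (i + 1) a)).edges ∨ e ∈ (seg (c i b) (c (i + 1) b)).edges) := by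
  classical
  -- At level `M` the only entry left is the top assignment, which all terminals share.
  have hex : ∃ m, levelLabel g M m a = levelLabel g M m b := by
    refine ⟨M, funext fun j => ?_⟩
    simp only [levelLabel]
    split_ifs with h
    · obtain rfl : j = M := le_antisymm h.2 h.1
      rw [hg _ le_rfl, hg _ le_rfl, hM a b]
    · rfl
  have hlt : Nat.find hex ≤ M := Nat.find_min' hex <| by
    refine funext fun j => ?_
    simp only [levelLabel]
    split_ifs with h
    · obtain rfl : j = M := le_antisymm h.2 h.1
      rw [hg _ le_rfl, hg _ le_rfl, hM a b]
    · rfl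
  have hspec := Nat.find_spec hex
  have hmin : ∀ i < Nat.find hex, levelLabel g M i a ≠ levelLabel g M i b :=
    fun i hi => Nat.find_min hex hi
  generalize Nat.find hex = m at hlt hspec hmin
  have hc : c m a = c m b := by
    have := congrFun hspec m
    simpa [levelLabel, hlt, hg] using this
  obtain ⟨w₁, h₁⟩ := exists_walk_climb h0 seg m a
  obtain ⟨w₂, h₂⟩ := exists_walk_climb h0 seg m b
  refine ⟨w₁.append (w₂.reverse.copy (by rw [hc]) rfl), fun e he => ?_⟩
  simp only [SimpleGraph.Walk.edges_append, SimpleGraph.Walk.edges_copy,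
    SimpleGraph.Walk.edges_reverse, List.mem_append, List.mem_reverse] at he
  rcases he with he | he
  · obtain ⟨i, hi, h⟩ := h₁ e he
    exact ⟨i, hi.trans_le hlt, hmin i hi, .inl h⟩
  · obtain ⟨i, hi, h⟩ := h₂ e he
    exact ⟨i, hi.trans_le hlt, hmin i hi, .inr h⟩

/-- Below level `M`, the label of a cell determines both its center and the next one up, so all
terminals of the cell share one segment. The default `a₀` never comes into play. -/
theorem getD_levelLabel {g : ℕ → V → Option K} {c : ℕ → K → K} {M : ℕ}
    (hg : ∀ j ≤ M, ∀ a : K, g j a = some (c j a)) (a₀ a : K) {i j : ℕ} (hij : i ≤ j) (hj : j ≤ M) :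
    (levelLabel g M i a j).getD a₀ = c j a := by
  simp [levelLabel, hij, hj, hg]

variable [Fintype V]

/-- The scheme `S` loads each edge `e` at most `L e` for every demand that can be routed within the
capacities. -/
def LoadsAtMost (cap : G.edgeSet → ℝ≥0) (S : ObliviousScheme G K) (L : G.edgeSet → ℝ≥0) : Prop :=
  ∀ (d : Demand K) (x : MultiFlow G K) (t : ℝ≥0), Routes x d → (∀ e, load x e ≤ t * cap e) →
    ∀ e, load (S.serve d) e ≤ t * L e

open scoped Classical in
/-- The capacity of the cut around `X`. -/
def cutCapacity (cap : G.edgeSet → ℝ≥0) (X : Set V) : ℝ≥0 :=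
  ∑ e : G.edgeSet, if Crosses X e then cap e else 0

open scoped Classical in
/-- The labels of the terminals at level `i`. -/
def terminalLabels (g : ℕ → V → Option K) (M i : ℕ) : Finset (ℕ → Option K) :=
  Finset.univ.image fun a : K => levelLabel g M i a

open scoped Classical in
/-- The capacity to be reserved on each edge for the traffic between successive centers, when the
terminals of each cell send as much as the cut around the cell permits. -/
def reserve (cap : G.edgeSet → ℝ≥0) (g : ℕ → V → Option K) (M : ℕ) (a₀ : K)
    (seg : ∀ a b : K, G.Walk (a : V) (b : V)) (e : G.edgeSet) : ℝ≥0 :=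
  ∑ i ∈ Finset.range M, ∑ s ∈ terminalLabels g M i,
    if (e : Sym2 V) ∈ (seg ((s i).getD a₀) ((s (i + 1)).getD a₀)).edges then
      cutCapacity cap {v | levelLabel g M i v = s} else 0

open scoped Classical in
-- A pair uses the segment of a cell only if the cell contains exactly one of its ends. The demand
-- of such pairs is at most `t` times the capacity of the cut around the cell.
theorem exists_scheme_loadsAtMost_reserve (cap : G.edgeSet → ℝ≥0) {g : ℕ → V → Option K}
    {c : ℕ → K → K} {M : ℕ} (hg : ∀ j ≤ M, ∀ a : K, g j a = some (c j a)) (h0 : ∀ a, c 0 a = a)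
    (hM : ∀ a b, c M a = c M b) (a₀ : K) (seg : ∀ a b : K, G.Walk (a : V) (b : V)) :
    ∃ S : ObliviousScheme G K, LoadsAtMost cap S (reserve cap g M a₀ seg) := by
  choose w hw using exists_walk_through_centers hg h0 hM seg
  refine ⟨ObliviousScheme.ofWalks w, fun d x t hx hload e => ?_⟩
  have h1 : ∀ a b : K, (if (e : Sym2 V) ∈ (w a b).edges then d a b else 0) ≤
      ∑ i ∈ Finset.range M, ∑ s ∈ terminalLabels g M i,
        if (e : Sym2 V) ∈ (seg ((s i).getD a₀) ((s (i + 1)).getD a₀)).edges then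
          if ¬((a : V) ∈ {v | levelLabel g M i v = s} ↔ (b : V) ∈ {v | levelLabel g M i v = s})
            then d a b else 0
        else 0 := by
    intro a b
    by_cases he : (e : Sym2 V) ∈ (w a b).edges
    · obtain ⟨i, hi, hne, hseg⟩ := hw a b e he
      obtain ⟨s, hs, hsab, hes⟩ : ∃ s ∈ terminalLabels g M i,
          (levelLabel g M i a = s ∨ levelLabel g M i b = s) ∧
          (e : Sym2 V) ∈ (seg ((s i).getD a₀) ((s (i + 1)).getD a₀)).edges := by
        rcases hseg with h | h
        · refine ⟨levelLabel g M i a, Finset.mem_image_of_mem _ (Finset.mem_univ a), .inl rfl, ?_⟩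
          rwa [getD_levelLabel hg _ _ le_rfl hi.le, getD_levelLabel hg _ _ (Nat.le_succ i) hi]
        · refine ⟨levelLabel g M i b, Finset.mem_image_of_mem _ (Finset.mem_univ b), .inr rfl, ?_⟩
          rwa [getD_levelLabel hg _ _ le_rfl hi.le, getD_levelLabel hg _ _ (Nat.le_succ i) hi]
      have hsep : ¬((a : V) ∈ {v | levelLabel g M i v = s} ↔
          (b : V) ∈ {v | levelLabel g M i v = s}) := by
        simp only [Set.mem_ofPred_eq]
        rcases hsab with rfl | rfl
        · exact fun h => hne (h.1 rfl).symm
        · exact fun h => hne (h.2 rfl)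
      rw [if_pos he]
      refine le_trans ?_ (Finset.single_le_sum (fun _ _ => bot_le) (Finset.mem_range.2 hi))
      refine le_trans ?_ (Finset.single_le_sum (fun _ _ => bot_le) hs)
      rw [if_pos hes, if_pos hsep]
    · rw [if_neg he]
      exact bot_le
  refine (load_ofWalks_serve_le w d e).trans
    ((Finset.sum_le_sum fun a _ => Finset.sum_le_sum fun b _ => h1 a b).trans ?_)
  have h2 : ∀ F : K → K → ℕ → ℝ≥0, ∑ a, ∑ b, ∑ i ∈ Finset.range M, F a b i =
      ∑ i ∈ Finset.range M, ∑ a, ∑ b, F a b i := by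
    intro F
    simp_rw [Finset.sum_comm (t := Finset.range M)]
  have h3 : ∀ (i : ℕ) (F : K → K → (ℕ → Option K) → ℝ≥0),
      ∑ a, ∑ b, ∑ s ∈ terminalLabels g M i, F a b s =
      ∑ s ∈ terminalLabels g M i, ∑ a, ∑ b, F a b s := by
    intro i F
    simp_rw [Finset.sum_comm (t := terminalLabels g M i)]
  rw [h2, reserve, Finset.mul_sum]
  refine Finset.sum_le_sum fun i _ => ?_
  rw [h3, Finset.mul_sum]
  refine Finset.sum_le_sum fun s _ => ?_
  by_cases hes : (e : Sym2 V) ∈ (seg ((s i).getD a₀) ((s (i + 1)).getD a₀)).edges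
  · simp only [if_pos hes]
    refine (sum_demand_le_sum_load hx _).trans ?_
    rw [cutCapacity, Finset.mul_sum]
    refine Finset.sum_le_sum fun e' _ => ?_
    split_ifs
    · exact hload e'
    · simp
  · simp [if_neg hes]

open scoped Classical in
/-- Each edge is in at most two of the cuts of a level, and in none if its ends have equal
labels. -/
theorem sum_cutCapacity_le (cap : G.edgeSet → ℝ≥0) {Λ : Type*} (f : V → Λ) (T : Finset Λ) :
    ∑ s ∈ T, cutCapacity cap {v | f v = s} ≤
      ∑ e : G.edgeSet, cap e * (2 * if (∃ u ∈ (e : Sym2 V), ∃ v ∈ (e : Sym2 V), f u ≠ f v)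
        then 1 else 0) := by
  simp only [cutCapacity]
  rw [Finset.sum_comm]
  refine Finset.sum_le_sum fun e _ => ?_
  rw [← Finset.sum_filter, Finset.sum_const, nsmul_eq_mul, mul_comm]
  refine mul_le_mul_of_nonneg_left ?_ bot_le
  obtain ⟨e, he⟩ := e
  induction e using Sym2.ind with
  | _ u v =>
    by_cases h : f u = f v
    · have : (T.filter fun s => Crosses {v | f v = s} s(u, v)) = ∅ := by
        refine Finset.filter_eq_empty_iff.2 fun s _ => ?_
        rw [crosses_mk, not_not]
        simp [h]
      simp [this]
    · rw [if_pos ⟨u, by simp, v, by simp, h⟩, mul_one]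
      have : (T.filter fun s => Crosses {v | f v = s} s(u, v)) ⊆ {f u, f v} := by
        intro s hs
        have := (Finset.mem_filter.1 hs).2
        rw [crosses_mk] at this
        simp only [Set.mem_ofPred_eq] at this
        simp only [Finset.mem_insert, Finset.mem_singleton]
        by_contra hcon
        push Not at hcon
        exact this ⟨fun h => absurd h.symm hcon.1, fun h => absurd h.symm hcon.2⟩
      exact_mod_cast (Finset.card_le_card this).trans Finset.card_le_two

open scoped Classical in
-- The constant 4 is a product of two factors 2: an edge lies in at most two cuts per level, and an
-- edge separated by `g j` can be cut at every level `i ≤ j`, at a total cost of `∑ 2 ^ i ≤ 2 * 2 ^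
-- j`.
theorem sum_mul_reserve_le (cap : G.edgeSet → ℝ≥0) {g : ℕ → V → Option K}
    {c : ℕ → K → K} {M : ℕ} (hg : ∀ j ≤ M, ∀ a : K, g j a = some (c j a)) (a₀ : K)
    (seg : ∀ a b : K, G.Walk (a : V) (b : V)) {l : Sym2 V → ℝ} (hl : ∀ e, 0 ≤ l e) {R : ℝ}
    (hR : 0 ≤ R) (hseg : ∀ i < M, ∀ a, walkLength l (seg (c i a) (c (i + 1) a)) ≤ R * 2 ^ i) :
    ∑ e : G.edgeSet, l e * (reserve cap g M a₀ seg e : ℝ) ≤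
      ∑ e : G.edgeSet, (cap e : ℝ) * (4 * ∑ j ∈ Finset.range (M + 1), R * 2 ^ j *
        if (∃ u ∈ (e : Sym2 V), ∃ v ∈ (e : Sym2 V), g j u ≠ g j v) then 1 else 0) := by
  have h1 : ∑ e : G.edgeSet, l e * (reserve cap g M a₀ seg e : ℝ) =
      ∑ i ∈ Finset.range M, ∑ s ∈ terminalLabels g M i,
        (cutCapacity cap {v | levelLabel g M i v = s} : ℝ) * ∑ e : G.edgeSet,
          if (e : Sym2 V) ∈ (seg ((s i).getD a₀) ((s (i + 1)).getD a₀)).edges then l e else 0 := by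
    simp only [reserve, NNReal.coe_sum, Finset.mul_sum]
    rw [Finset.sum_comm]
    refine Finset.sum_congr rfl fun i _ => ?_
    rw [Finset.sum_comm]
    refine Finset.sum_congr rfl fun s _ => Finset.sum_congr rfl fun e _ => ?_
    split_ifs <;> simp [mul_comm]
  have h2 : ∀ i ∈ Finset.range M, (∑ s ∈ terminalLabels g M i,
        (cutCapacity cap {v | levelLabel g M i v = s} : ℝ) * ∑ e : G.edgeSet,
          if (e : Sym2 V) ∈ (seg ((s i).getD a₀) ((s (i + 1)).getD a₀)).edges then l e else 0) ≤
      R * 2 ^ i * ∑ e : G.edgeSet, (cap e : ℝ) * (2 * ∑ j ∈ Finset.range (M + 1),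
        if i ≤ j ∧ (∃ u ∈ (e : Sym2 V), ∃ v ∈ (e : Sym2 V), g j u ≠ g j v) then 1 else 0) := by
    intro i hi
    have hi' : i < M := Finset.mem_range.1 hi
    have h3 : ∀ s ∈ terminalLabels g M i,
        (cutCapacity cap {v | levelLabel g M i v = s} : ℝ) * (∑ e : G.edgeSet,
          if (e : Sym2 V) ∈ (seg ((s i).getD a₀) ((s (i + 1)).getD a₀)).edges then l e else 0) ≤
        R * 2 ^ i * (cutCapacity cap {v | levelLabel g M i v = s} : ℝ) := by
      intro s hs
      obtain ⟨a, -, rfl⟩ := Finset.mem_image.1 hs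
      rw [mul_comm]
      refine mul_le_mul_of_nonneg_right ?_ (NNReal.coe_nonneg _)
      refine (sum_mem_edges_le hl _).trans ?_
      rw [getD_levelLabel hg _ _ le_rfl hi'.le, getD_levelLabel hg _ _ (Nat.le_succ i) hi']
      exact hseg i hi' a
    refine (Finset.sum_le_sum h3).trans ?_
    rw [← Finset.mul_sum]
    refine mul_le_mul_of_nonneg_left ?_ (by positivity)
    have h4 := sum_cutCapacity_le cap (levelLabel g M i) (terminalLabels g M i)
    have h5 := NNReal.coe_le_coe.2 h4
    push_cast at h5
    refine h5.trans (Finset.sum_le_sum fun e _ => ?_)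
    refine mul_le_mul_of_nonneg_left (mul_le_mul_of_nonneg_left ?_ zero_le_two)
      (NNReal.coe_nonneg _)
    by_cases h : ∃ u ∈ (e : Sym2 V), ∃ v ∈ (e : Sym2 V), levelLabel g M i u ≠ levelLabel g M i v
    · rw [if_pos h]
      obtain ⟨u, hu, v, hv, huv⟩ := h
      obtain ⟨j, hj⟩ := Function.ne_iff.1 huv
      simp only [levelLabel] at hj
      split_ifs at hj with hij
      · refine le_trans ?_ (Finset.single_le_sum (fun _ _ => by positivity)
          (Finset.mem_range.2 (Nat.lt_succ_of_le hij.2)))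
        rw [if_pos ⟨hij.1, u, hu, v, hv, hj⟩, NNReal.coe_one]
      · exact absurd rfl hj
    · rw [if_neg h, NNReal.coe_zero]
      exact Finset.sum_nonneg fun _ _ => by positivity
  rw [h1]
  refine (Finset.sum_le_sum h2).trans ?_
  simp only [Finset.mul_sum]
  rw [Finset.sum_comm]
  refine Finset.sum_le_sum fun e _ => ?_
  rw [Finset.sum_comm]
  refine Finset.sum_le_sum fun j _ => ?_
  by_cases h : ∃ u ∈ (e : Sym2 V), ∃ v ∈ (e : Sym2 V), g j u ≠ g j v
  · simp only [h, and_true, if_true]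
    have hgeom : ∀ n : ℕ, ∑ i ∈ Finset.range n, (2 : ℝ) ^ i * (if i ≤ j then 1 else 0) ≤
        2 * 2 ^ j := by
      intro n
      calc ∑ i ∈ Finset.range n, (2 : ℝ) ^ i * (if i ≤ j then 1 else 0)
          = ∑ i ∈ (Finset.range n).filter (· ≤ j), (2 : ℝ) ^ i := by
            simp [Finset.sum_filter]
        _ ≤ ∑ i ∈ Finset.range (j + 1), (2 : ℝ) ^ i := by
            refine Finset.sum_le_sum_of_subset_of_nonneg ?_ fun _ _ _ => by positivity
            intro i hi
            simp only [Finset.mem_filter] at hi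
            exact Finset.mem_range.2 (Nat.lt_succ_of_le hi.2)
        _ ≤ 2 * 2 ^ j := by
            rw [geom_sum_eq (by norm_num)]
            rw [pow_succ]
            linarith
    calc ∑ i ∈ Finset.range M, R * 2 ^ i * ((cap e : ℝ) * (2 * if i ≤ j then 1 else 0))
        = (2 * R * cap e) * ∑ i ∈ Finset.range M, (2 : ℝ) ^ i * (if i ≤ j then 1 else 0) := by
          rw [Finset.mul_sum]
          exact Finset.sum_congr rfl fun i _ => by ring
      _ ≤ (2 * R * cap e) * (2 * 2 ^ j) := mul_le_mul_of_nonneg_left (hgeom M) (by positivity)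
      _ = _ := by ring
  · simp [h]

end Hierarchy

/-! ### From edge lengths to a competitive scheme. -/

section Competitive
variable {V : Type*} {G : SimpleGraph V} {K : Finset V}

theorem exists_ne_iff_of_eq_mk {Λ : Type*} (f : V → Λ) {e : Sym2 V} {x y : V} (h : e = s(x, y)) :
    (∃ u ∈ e, ∃ v ∈ e, f u ≠ f v) ↔ f x ≠ f y := by
  subst h
  simp only [Sym2.mem_iff]
  constructor
  · rintro ⟨u, rfl | rfl, v, rfl | rfl, h⟩
    exacts [absurd rfl h, h, h.symm, absurd rfl h]
  · exact fun h => ⟨_, .inl rfl, _, .inr rfl, h⟩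

variable [Fintype V]

open scoped Classical in
/-- For all positive edge lengths, some scheme has small total reserved length. -/
theorem exists_scheme_of_lengths (hK : ∀ a ∈ K, ∀ b ∈ K, G.Reachable a b) (hne : K.Nonempty)
    (cap : G.edgeSet → ℝ≥0) {l : Sym2 V → ℝ} (hl : ∀ e, 0 < l e) :
    ∃ (S : ObliviousScheme G K) (L : G.edgeSet → ℝ≥0), LoadsAtMost cap S L ∧
      ∑ e : G.edgeSet, l e * (L e : ℝ) ≤
        24 * (harmonic K.card : ℝ) * ∑ e : G.edgeSet, (cap e : ℝ) * l e := by
  have hl0 : ∀ e, 0 ≤ l e := fun e => (hl e).le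
  obtain ⟨a₀, ha₀⟩ := hne
  obtain ⟨ε, hε0, hε⟩ : ∃ ε : ℝ, 0 < ε ∧ ∀ e, ε ≤ l e := by
    have : Nonempty (Sym2 V) := ⟨s(a₀, a₀)⟩
    obtain ⟨e₀, h⟩ := Finite.exists_min l
    exact ⟨l e₀, hl e₀, h⟩
  -- Then the radius at level 0 is below `ε / 2`, and each terminal is its own center.
  set s : ℝ := ε / 4 with hs
  have hs0 : 0 < s := by positivity
  set D : V → K → ℝ := fun v w => pathDist G l v w with hD
  -- At level `M` the ball around any terminal contains all of `K`, so the centers coincide.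
  obtain ⟨M, hM⟩ : ∃ M : ℕ, ∀ a b : K, D a b ≤ s * 2 ^ M := by
    obtain ⟨p₀, hp₀⟩ : ∃ p₀ : K × K, ∀ p : K × K, D p.1 p.2 ≤ D p₀.1 p₀.2 := by
      have : Nonempty (K × K) := ⟨(⟨a₀, ha₀⟩, ⟨a₀, ha₀⟩)⟩
      exact Finite.exists_max fun p : K × K => D p.1 p.2
    obtain ⟨M, h⟩ := pow_unbounded_of_one_lt (D p₀.1 p₀.2 / s) (one_lt_two (α := ℝ))
    rw [div_lt_iff₀ hs0] at h
    exact ⟨M, fun a b => (hp₀ (a, b)).trans (by linarith)⟩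
  have hends : ∀ e : G.edgeSet, (e : Sym2 V) =
      s((Quot.out (e : Sym2 V)).1, (Quot.out (e : Sym2 V)).2) :=
    fun e => (Quot.out_eq (e : Sym2 V)).symm
  obtain ⟨β, hβ, σ, hσ, hsum⟩ := exists_assignment D
    (fun e : G.edgeSet => (Quot.out (e : Sym2 V)).1)
    (fun e : G.edgeSet => (Quot.out (e : Sym2 V)).2)
    (fun e => (cap e : ℝ)) (fun e => l e) (fun e => NNReal.coe_nonneg _)
    (fun e w => by
      have hadj : G.Adj (Quot.out (e : Sym2 V)).1 (Quot.out (e : Sym2 V)).2 := by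
        rw [← SimpleGraph.mem_edgeSet, ← hends e]
        exact e.2
      have := abs_pathDist_sub_le hl0 hadj (w : V)
      rwa [← hends e] at this) hs0 (M + 1)
  set B : ℕ → V → Finset K := fun j v => Finset.univ.filter fun w => D v w ≤ s * 2 ^ j * β with hB
  set g : ℕ → V → Option K := fun j v => firstMember σ (B j v) with hg
  have hβ0 : 0 < β := by linarith [hβ.1]
  have hself : ∀ j (a : K), a ∈ B j a := fun j a => by
    simp only [B, Finset.mem_filter, Finset.mem_univ, true_and]
    exact (pathDist_self hl0 _).trans (by positivity)
  have hsome : ∀ j (a : K), ∃ w, g j a = some w := fun j a => by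
    refine Option.ne_none_iff_exists'.1 fun h => ?_
    have := firstMember_eq_none.1 h
    exact absurd (hself j a) (by rw [this]; simp)
  choose c hc using hsome
  have hcB : ∀ j (a : K), D a (c j a) ≤ s * 2 ^ j * β := fun j a => by
    have := ((firstMember_eq_some hσ).1 (hc j a)).1
    simpa [B] using this
  have hreach : ∀ a b : K, G.Reachable (a : V) b := fun a b => hK a a.2 b b.2
  have h0 : ∀ a, c 0 a = a := by
    intro a
    by_contra hne
    have h1 := hcB 0 a
    have h2 := le_pathDist hl0 hε (u := a) (v := c 0 a)
      (fun h => hne (Subtype.ext h).symm) (hreach _ _)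
    have h3 : s * 2 ^ 0 * β ≤ ε / 2 := by
      rw [pow_zero, hs]
      nlinarith [hβ.2]
    simp only [D] at h1
    linarith
  have hcM : ∀ a b, c M a = c M b := by
    have hall : ∀ a : K, B M a = Finset.univ := fun a => Finset.filter_true_of_mem fun w _ =>
      (hM a w).trans (le_mul_of_one_le_right (by positivity) hβ.1)
    intro a b
    have h1 := hc M a
    have h2 := hc M b
    simp only [g, hall] at h1 h2
    exact Option.some_injective _ (h1.symm.trans h2)
  choose seg hseg using fun a b : K => exists_walkLength_eq (l := l) (hreach a b)
  obtain ⟨S, hS⟩ := exists_scheme_loadsAtMost_reserve cap (g := g) (M := M)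
    (fun j _ a => hc j a) h0 hcM ⟨a₀, ha₀⟩ seg
  refine ⟨S, _, hS, ?_⟩
  -- The detour through `a` costs at most `(1 + 2) * β` times `s * 2 ^ i`, and `β < 2`. Together
  -- with the 4 of `sum_mul_reserve_le` this gives 24.
  have hstep : ∀ i < M, ∀ a, walkLength l (seg (c i a) (c (i + 1) a)) ≤ (6 * s) * 2 ^ i := by
    intro i _ a
    rw [hseg]
    have h1 := hcB i a
    have h2 := hcB (i + 1) a
    have h3 := pathDist_triangle hl0 (hreach (c i a) a) (hreach a (c (i + 1) a))
    rw [pathDist_comm hl0 (c i a : V) a] at h3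
    simp only [D] at h1 h2
    have h4 : s * 2 ^ i * β + s * 2 ^ (i + 1) * β ≤ 6 * s * 2 ^ i := by
      have h5 : 0 < s * 2 ^ i := by positivity
      rw [pow_succ]
      nlinarith [hβ.2]
    linarith
  refine (sum_mul_reserve_le cap (fun j _ a => hc j a) ⟨a₀, ha₀⟩ seg hl0 (R := 6 * s)
    (by positivity) hstep).trans ?_
  rw [Fintype.card_coe] at hsum
  calc _ = 24 * ∑ e : G.edgeSet, (cap e : ℝ) * ∑ j ∈ Finset.range (M + 1), s * 2 ^ j *
        (if g j (Quot.out (e : Sym2 V)).1 ≠ g j (Quot.out (e : Sym2 V)).2 then 1 else 0) := by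
        rw [Finset.mul_sum]
        refine Finset.sum_congr rfl fun e _ => ?_
        simp only [Finset.mul_sum]
        refine Finset.sum_congr rfl fun j _ => ?_
        have hiff : (∃ u ∈ (e : Sym2 V), ∃ v ∈ (e : Sym2 V), g j u ≠ g j v) ↔
            g j (Quot.out (e : Sym2 V)).1 ≠ g j (Quot.out (e : Sym2 V)).2 :=
          exists_ne_iff_of_eq_mk _ (hends e)
        simp only [hiff]
        ring
    _ ≤ 24 * ((harmonic K.card : ℝ) * ∑ e : G.edgeSet, (cap e : ℝ) * l e) :=
        mul_le_mul_of_nonneg_left hsum (by norm_num)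
    _ = _ := by ring

/-- The convex combination of two schemes. -/
def ObliviousScheme.combine (S T : ObliviousScheme G K) (p q : ℝ≥0) (h : p + q = 1) :
    ObliviousScheme G K where
  flow a b P := p * S.flow a b P + q * T.flow a b P
  unit a b := by
    rw [Finset.sum_add_distrib, ← Finset.mul_sum, ← Finset.mul_sum, S.unit a b, T.unit a b,
      mul_one, mul_one, h]

theorem load_combine_serve (S T : ObliviousScheme G K) (p q : ℝ≥0) (h : p + q = 1) (d : Demand K)
    (e : G.edgeSet) : load ((S.combine T p q h).serve d) e =
      p * load (S.serve d) e + q * load (T.serve d) e := by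
  have : ∀ a b, pairLoad (S.combine T p q h).flow a b e =
      p * pairLoad S.flow a b e + q * pairLoad T.flow a b e := by
    intro a b
    simp only [pairLoad, ObliviousScheme.combine, Finset.mul_sum, ← Finset.sum_add_distrib]
    refine Finset.sum_congr rfl fun P _ => ?_
    split_ifs <;> simp
  simp only [load_serve, this, Finset.mul_sum, ← Finset.sum_add_distrib]
  refine Finset.sum_congr rfl fun a _ => Finset.sum_congr rfl fun b _ => ?_
  ring

theorem LoadsAtMost.combine {cap : G.edgeSet → ℝ≥0} {S T : ObliviousScheme G K}
    {L L' : G.edgeSet → ℝ≥0} (hS : LoadsAtMost cap S L) (hT : LoadsAtMost cap T L') (p q : ℝ≥0)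
    (h : p + q = 1) : LoadsAtMost cap (S.combine T p q h) fun e => p * L e + q * L' e := by
  intro d x t hx hload e
  rw [load_combine_serve]
  calc p * load (S.serve d) e + q * load (T.serve d) e
      ≤ p * (t * L e) + q * (t * L' e) := by
        gcongr
        exacts [hS d x t hx hload e, hT d x t hx hload e]
    _ = t * (p * L e + q * L' e) := by ring

open scoped Classical in
/-- Passage from all edge lengths to a single scheme, by separation of convex sets. -/
theorem exists_scheme_of_pos (cap : G.edgeSet → ℝ≥0) (hcap : ∀ e, 0 < cap e) {N : ℝ≥0}
    (hN : 0 < N)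
    (H : ∀ l : Sym2 V → ℝ, (∀ e, 0 < l e) →
      ∃ (S : ObliviousScheme G K) (L : G.edgeSet → ℝ≥0), LoadsAtMost cap S L ∧
        ∑ e : G.edgeSet, l e * (L e : ℝ) ≤ N * ∑ e : G.edgeSet, (cap e : ℝ) * l e) :
    ∃ S : ObliviousScheme G K, LoadsAtMost cap S fun e => 4 * N * cap e := by
  by_contra hcon
  push Not at hcon
  -- The factor 4 leaves room for the point `2 * N * cap` inside the open box, and for a factor 2
  -- lost in making the lengths positive.
  set A : Set (G.edgeSet → ℝ) := Set.univ.pi fun e => Set.Iio (4 * N * cap e) with hA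
  set T : Set (G.edgeSet → ℝ) :=
    {y | ∃ (S : ObliviousScheme G K) (L : G.edgeSet → ℝ≥0), LoadsAtMost cap S L ∧
      y = fun e => (L e : ℝ)} with hT
  have hAconv : Convex ℝ A := convex_pi fun e _ => convex_Iio _
  have hAopen : IsOpen A := isOpen_set_pi Set.finite_univ fun e _ => isOpen_Iio
  have hTconv : Convex ℝ T := by
    rintro _ ⟨S, L, hS, rfl⟩ _ ⟨S', L', hS', rfl⟩ p q hp hq hpq
    lift p to ℝ≥0 using hp
    lift q to ℝ≥0 using hq
    refine ⟨S.combine S' p q (by exact_mod_cast hpq), _, hS.combine hS' p q _, ?_⟩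
    ext e
    simp
  have hdisj : Disjoint A T := by
    refine Set.disjoint_left.2 ?_
    rintro _ hy ⟨S, L, hS, rfl⟩
    refine hcon S fun d x t hx hload e => (hS d x t hx hload e).trans ?_
    have : (L e : ℝ) < 4 * N * cap e := hy e (Set.mem_univ e)
    gcongr
    exact_mod_cast this.le
  obtain ⟨f, u, hfA, hfT⟩ := geometric_hahn_banach_open hAconv hAopen hTconv hdisj
  set l : G.edgeSet → ℝ := fun e => f (Pi.single e 1) with hl
  have hf : ∀ y, f y = ∑ e, y e * l e := fun y => by
    conv_lhs => rw [← Finset.univ_sum_single y]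
    rw [map_sum]
    refine Finset.sum_congr rfl fun e _ => ?_
    have : Pi.single e (y e) = y e • (Pi.single e (1 : ℝ) : G.edgeSet → ℝ) := by
      rw [← Pi.single_smul, smul_eq_mul, mul_one]
    rw [this, map_smul, smul_eq_mul]
  -- The box is unbounded in every negative coordinate direction, where a functional bounded above
  -- cannot increase.
  have hl0 : ∀ e, 0 ≤ l e := by
    intro e
    by_contra hneg
    push Not at hneg
    set r : ℝ := max 0 ((u - f 0) / (-l e)) with hr
    have hmem : (-r) • (Pi.single e (1 : ℝ) : G.edgeSet → ℝ) ∈ A := by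
      intro e' _
      have hpos : (0 : ℝ) < 4 * N * cap e' := by
        have := hcap e'
        positivity
      have hle : ((-r) • (Pi.single e (1 : ℝ) : G.edgeSet → ℝ)) e' ≤ 0 := by
        have h1 : (0 : ℝ) ≤ (Pi.single e (1 : ℝ) : G.edgeSet → ℝ) e' := by
          rw [Pi.single_apply]; split_ifs <;> norm_num
        have h2 : 0 ≤ r := le_max_left _ _
        simp only [Pi.smul_apply, smul_eq_mul]
        nlinarith
      exact hle.trans_lt hpos
    have h1 := hfA _ hmem
    rw [map_smul, smul_eq_mul] at h1
    have h2 : (u - f 0) / (-l e) ≤ r := le_max_right _ _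
    rw [div_le_iff₀ (by linarith), map_zero] at h2
    have h3 : f (Pi.single e 1) = l e := rfl
    rw [h3] at h1
    linarith
  set Q : ℝ := ∑ e, (cap e : ℝ) * l e with hQ
  have hQ0 : 0 ≤ Q := Finset.sum_nonneg fun e _ => mul_nonneg (NNReal.coe_nonneg _) (hl0 e)
  have hu : 2 * N * Q < u := by
    have hmem : (fun e => 2 * (N : ℝ) * cap e) ∈ A := by
      intro e _
      have : (0 : ℝ) < N * cap e := by
        have := hcap e
        positivity
      simp only [Set.mem_Iio]
      linarith
    have := hfA _ hmem
    rw [hf] at this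
    rw [hQ, Finset.mul_sum]
    refine lt_of_eq_of_lt (Finset.sum_congr rfl fun e _ => ?_) this
    ring
  -- The separating lengths may vanish, so `ε` is added to each. The value 1 off the edge set is
  -- arbitrary.
  have hmain : ∀ ε : ℝ, 0 < ε → u ≤ N * (Q + ε * ∑ e : G.edgeSet, (cap e : ℝ)) := by
    intro ε hε
    obtain ⟨S, L, hS, hL⟩ := H (fun e => if h : e ∈ G.edgeSet then l ⟨e, h⟩ + ε else 1) (by
      intro e
      split_ifs with h
      · linarith [hl0 ⟨e, h⟩]
      · norm_num)
    have h1 := hfT _ ⟨S, L, hS, rfl⟩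
    rw [hf] at h1
    simp only [Subtype.coe_prop, dite_true, Subtype.coe_eta] at hL
    have h2 : ∑ e : G.edgeSet, (L e : ℝ) * l e ≤ ∑ e : G.edgeSet, (l e + ε) * (L e : ℝ) :=
      Finset.sum_le_sum fun e _ => by
        have := NNReal.coe_nonneg (L e)
        nlinarith
    refine h1.trans (h2.trans (hL.trans_eq ?_))
    congr 1
    rw [hQ, Finset.mul_sum, ← Finset.sum_add_distrib]
    exact Finset.sum_congr rfl fun e _ => by ring
  -- If `Q = 0` the functional is zero, yet it is at least `u > 0` on a good vector.
  rcases hQ0.eq_or_lt with h0 | hpos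
  · have hl_zero : ∀ e, l e = 0 := fun e => by
      have := (Finset.sum_eq_zero_iff_of_nonneg fun e _ =>
        mul_nonneg (NNReal.coe_nonneg (cap e)) (hl0 e)).1 h0.symm e (Finset.mem_univ e)
      exact (mul_eq_zero.1 this).resolve_left (by exact_mod_cast (hcap e).ne')
    obtain ⟨S, L, hS, -⟩ := H (fun _ => 1) fun _ => one_pos
    have h1 := hfT _ ⟨S, L, hS, rfl⟩
    rw [hf] at h1
    simp only [hl_zero, mul_zero, Finset.sum_const_zero] at h1
    rw [← h0, mul_zero] at hu
    linarith
  · set W : ℝ := ∑ e : G.edgeSet, (cap e : ℝ)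
    have hW : 0 ≤ W := Finset.sum_nonneg fun e _ => NNReal.coe_nonneg _
    -- With this `ε` the bound becomes `u ≤ 2 * N * Q`, contrary to `hu`.
    have h1 := hmain (Q / (W + 1)) (by positivity)
    have h2 : Q / (W + 1) * W ≤ Q := by
      rw [div_mul_eq_mul_div, div_le_iff₀ (by positivity)]
      nlinarith
    have h3 : (0 : ℝ) < N := hN
    nlinarith

theorem continuous_load_serve (d : Demand K) (e : G.edgeSet) :
    Continuous fun x : MultiFlow G K => ∑ a : K, ∑ b : K, d a b * pairLoad x a b e := by
  unfold pairLoad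
  refine continuous_finsetSum _ fun a _ => continuous_finsetSum _ fun b _ =>
    continuous_const.mul (continuous_finsetSum _ fun P _ => ?_)
  split_ifs
  · fun_prop
  · exact continuous_const

/-- Capacities `0` are limits of positive capacities. -/
theorem exists_scheme_of_forall_pos {N : ℝ≥0}
    (H : ∀ cap : G.edgeSet → ℝ≥0, (∀ e, 0 < cap e) →
      ∃ S : ObliviousScheme G K, LoadsAtMost cap S fun e => N * cap e) (cap : G.edgeSet → ℝ≥0) :
    ∃ S : ObliviousScheme G K, LoadsAtMost cap S fun e => N * cap e := by
  classical
  -- The unit flows that work for the capacities raised by `1 / (n + 1)`, tested only on demands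
  -- routable in the original ones: a decreasing sequence of nonempty compact sets.
  set Z : ℕ → Set (MultiFlow G K) := fun n => {f | Routes f (fun _ _ => 1) ∧
    ∀ (d : Demand K) (x : MultiFlow G K) (t : ℝ≥0), Routes x d → (∀ e, load x e ≤ t * cap e) →
      ∀ e, ∑ a : K, ∑ b : K, d a b * pairLoad f a b e ≤ t * (N * (cap e + 1 / ((n : ℝ≥0) + 1)))}
    with hZ
  have hclosed : ∀ n, IsClosed (Z n) := by
    intro n
    have h1 : Z n = (⋂ (a : K) (b : K), {f | ∑ P : G.Path (a : V) (b : V), f a b P = 1}) ∩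
        ⋂ (d : Demand K) (x : MultiFlow G K) (t : ℝ≥0) (_ : Routes x d)
          (_ : ∀ e, load x e ≤ t * cap e) (e : G.edgeSet), {f | ∑ a : K, ∑ b : K,
            d a b * pairLoad f a b e ≤ t * (N * (cap e + 1 / ((n : ℝ≥0) + 1)))} := by
      ext f
      simp only [Z, Set.mem_inter_iff, Set.mem_iInter, Set.mem_ofPred_eq, Routes]
    rw [h1]
    refine IsClosed.inter ?_ ?_
    · refine isClosed_iInter fun a => isClosed_iInter fun b => isClosed_eq ?_ continuous_const
      exact continuous_finsetSum _ fun P _ => by fun_prop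
    · exact isClosed_iInter fun d => isClosed_iInter fun x => isClosed_iInter fun t =>
        isClosed_iInter fun _ => isClosed_iInter fun _ => isClosed_iInter fun e =>
        isClosed_le (continuous_load_serve d e) continuous_const
  have hcompact : IsCompact (Z 0) := by
    have hbox : IsCompact (Set.univ.pi fun a : K => Set.univ.pi fun b : K =>
        Set.univ.pi fun _ : G.Path (a : V) (b : V) => Set.Icc (0 : ℝ≥0) 1) :=
      isCompact_univ_pi fun a => isCompact_univ_pi fun b => isCompact_univ_pi fun P =>
        isCompact_Icc
    refine hbox.of_isClosed_subset (hclosed 0) fun f hf a _ b _ P _ => ⟨bot_le, ?_⟩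
    exact (Finset.single_le_sum (f := fun P => f a b P) (fun _ _ => bot_le)
      (Finset.mem_univ P)).trans_eq (hf.1 a b)
  have hanti : ∀ n, Z (n + 1) ⊆ Z n := by
    rintro n f ⟨h1, h2⟩
    refine ⟨h1, fun d x t hx hload e => (h2 d x t hx hload e).trans ?_⟩
    gcongr
    simp
  have hne : ∀ n, (Z n).Nonempty := by
    intro n
    obtain ⟨S, hS⟩ := H (fun e => cap e + 1 / ((n : ℝ≥0) + 1)) fun e => by positivity
    refine ⟨S.flow, S.unit, fun d x t hx hload e => ?_⟩
    rw [← load_serve]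
    refine hS d x t hx (fun e => (hload e).trans ?_) e
    gcongr
    exact le_self_add
  obtain ⟨f, hf⟩ := IsCompact.nonempty_iInter_of_sequence_nonempty_isCompact_isClosed Z hanti hne
    hcompact hclosed
  rw [Set.mem_iInter] at hf
  refine ⟨⟨f, (hf 0).1⟩, fun d x t hx hload e => ?_⟩
  rw [load_serve]
  have hlim : Filter.Tendsto (fun n : ℕ => t * (N * (cap e + 1 / ((n : ℝ≥0) + 1)))) Filter.atTop
      (nhds (t * (N * (cap e + 0)))) :=
    ((tendsto_one_div_add_atTop_nhds_zero_nat.const_add _).const_mul _).const_mul _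
  rw [add_zero] at hlim
  exact ge_of_tendsto' hlim fun n => (hf n).2 d x t hx hload e

theorem LoadsAtMost.congestion_serve_le {cap : G.edgeSet → ℝ≥0} {S : ObliviousScheme G K} {N : ℝ≥0}
    (hN : 0 < N) (hS : LoadsAtMost cap S fun e => N * cap e) (d : Demand K) :
    congestion cap (S.serve d) ≤ N * optCongestion cap d := by
  simp only [optCongestion]
  rw [ENNReal.mul_iInf_of_ne (by exact_mod_cast hN.ne') ENNReal.coe_ne_top]
  refine le_iInf fun x => ?_
  rw [ENNReal.mul_iInf_of_ne (by exact_mod_cast hN.ne') ENNReal.coe_ne_top]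
  refine le_iInf fun hx => ?_
  by_cases htop : congestion cap x = ⊤
  · rw [htop, ENNReal.mul_top (by exact_mod_cast hN.ne')]
    exact le_top
  · lift congestion cap x to ℝ≥0 using htop with t ht
    rw [← ENNReal.coe_mul]
    refine congestion_le_of_load_le fun e => ?_
    refine (hS d x t hx (fun e => load_le_of_congestion_le ht.ge e) e).trans_eq ?_
    ring

theorem congestion_eq_zero_of_subsingleton [Subsingleton K] (cap : G.edgeSet → ℝ≥0)
    (x : MultiFlow G K) : congestion cap x = 0 := by
  classical
  rw [← nonpos_iff_eq_zero]
  refine congestion_le_of_load_le (t := 0) fun e => ?_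
  rw [zero_mul, nonpos_iff_eq_zero, load_eq_sum_pairLoad]
  refine Finset.sum_eq_zero fun a _ => Finset.sum_eq_zero fun b _ => ?_
  obtain rfl := Subsingleton.elim a b
  exact Finset.sum_eq_zero fun P _ => by simp [P.loop_eq]

theorem harmonic_le_three_mul_log {k : ℕ} (hk : 2 ≤ k) : (harmonic k : ℝ) ≤ 3 * Real.log k := by
  have h1 := harmonic_le_one_add_log k
  have h2 : Real.log 2 ≤ Real.log k := Real.log_le_log two_pos (by exact_mod_cast hk)
  have := Real.log_two_gt_d9
  linarith

/-- Oblivious routing between `k` terminals is `O(log k)`-competitive. -/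
theorem exists_competitive_scheme (cap : G.edgeSet → ℝ≥0)
    (hK : ∀ a ∈ K, ∀ b ∈ K, G.Reachable a b) :
    ∃ S : ObliviousScheme G K, ∀ d : Demand K, congestion cap (S.serve d) ≤
      ENNReal.ofReal (288 * Real.log K.card) * optCongestion cap d := by
  classical
  rcases le_or_gt K.card 1 with h1 | h2
  -- Here the logarithm is 0, so the congestion itself must vanish; it does, since a path from a
  -- terminal to itself has no edges.
  · have : Subsingleton K := ⟨fun a b => Subtype.ext (Finset.card_le_one.1 h1 a a.2 b b.2)⟩
    have hw : ∀ a b : K, Nonempty (G.Walk (a : V) (b : V)) := fun a b => hK a a.2 b b.2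
    refine ⟨ObliviousScheme.ofWalks fun a b => (hw a b).some, fun d => ?_⟩
    rw [congestion_eq_zero_of_subsingleton]
    exact bot_le
  · have hlog : 0 < Real.log K.card := Real.log_pos (by exact_mod_cast h2)
    -- 72 is 24 times the 3 of `harmonic_le_three_mul_log`; the separation argument turns `N` into
    -- `4 * N`, whence 288.
    set N : ℝ≥0 := ⟨72 * Real.log K.card, by positivity⟩ with hN
    have hNpos : 0 < N := by
      rw [← NNReal.coe_pos]
      exact mul_pos (by norm_num) hlog
    obtain ⟨S, hS⟩ := exists_scheme_of_forall_pos (N := 4 * N) (fun cap hcap =>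
      exists_scheme_of_pos cap hcap hNpos fun l hl => by
        obtain ⟨S, L, hS, hL⟩ := exists_scheme_of_lengths hK
          (Finset.card_pos.1 (by omega)) cap hl
        refine ⟨S, L, hS, hL.trans (mul_le_mul_of_nonneg_right ?_ (Finset.sum_nonneg fun e _ =>
          mul_nonneg (NNReal.coe_nonneg _) (hl _).le))⟩
        have := harmonic_le_three_mul_log h2
        change _ ≤ 72 * Real.log K.card
        linarith) cap
    refine ⟨S, fun d => (hS.congestion_serve_le (by positivity) d).trans_eq ?_⟩
    congr 1
    rw [ENNReal.ofReal, ENNReal.coe_inj]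
    ext
    rw [Real.coe_toNNReal _ (by positivity)]
    change 4 * (72 * Real.log K.card) = _
    ring

end Competitive

/-! ### Unit demands and flows along walks. -/

section WalkFlows
variable {V : Type*} {G : SimpleGraph V} {K : Finset V}

theorem abs_sub_le_sum_edges {φ : V → ℤ} {ω : Sym2 V → ℤ}
    (h : ∀ u v, G.Adj u v → |φ u - φ v| ≤ ω s(u, v)) {u v : V} (p : G.Walk u v) :
    |φ u - φ v| ≤ (p.edges.map ω).sum := by
  induction p with
  | nil => simp
  | @cons u x v hadj q ih =>
    simp only [SimpleGraph.Walk.edges_cons, List.map_cons, List.sum_cons]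
    calc |φ u - φ v| ≤ |φ u - φ x| + |φ x - φ v| := abs_sub_le _ _ _
      _ ≤ _ := add_le_add (h _ _ hadj) ih

variable [Fintype V]

open scoped Classical in
/-- The demand consisting of one unit for each member of a family of pairs. -/
def unitDemands {I : Type*} [Fintype I] (s t : I → K) : Demand K :=
  fun a b => ∑ i, if s i = a ∧ t i = b then 1 else 0

open scoped Classical in
/-- A flow that follows given walks, freed of their cycles. -/
theorem exists_flow_of_walks {I : Type*} [Fintype I] (s t : I → K)
    (w : ∀ i, G.Walk (s i : V) (t i : V)) :
    ∃ x : MultiFlow G K, Routes x (unitDemands s t) ∧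
      ∀ e : G.edgeSet, load x e ≤ ∑ i, if (e : Sym2 V) ∈ (w i).edges then 1 else 0 := by
  -- Comparing supports avoids transporting the path along `s i = a` and `t i = b`.
  set y : I → MultiFlow G K := fun i a b P =>
    if s i = a ∧ t i = b ∧ P.1.support = (w i).bypass.support then 1 else 0 with hy
  have hiff : ∀ i (P : G.Path (s i : V) (t i : V)),
      P.1.support = (w i).bypass.support ↔ P = (w i).toPath := by
    intro i P
    refine ⟨fun h => Subtype.ext (SimpleGraph.Walk.ext_support h), ?_⟩
    rintro rfl
    rfl
  refine ⟨fun a b P => ∑ i, y i a b P, fun a b => ?_, fun e => ?_⟩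
  · rw [Finset.sum_comm, unitDemands]
    refine Finset.sum_congr rfl fun i _ => ?_
    split_ifs with h
    · obtain ⟨rfl, rfl⟩ := h
      simp [y, hiff]
    · exact Finset.sum_eq_zero fun P _ => if_neg fun hc => h ⟨hc.1, hc.2.1⟩
  · have h1 : load (fun a b P => ∑ i, y i a b P) e = ∑ i, ∑ a, ∑ b, pairLoad (y i) a b e := by
      have h2 : ∀ a b, pairLoad (fun a b P => ∑ i, y i a b P) a b e =
          ∑ i, pairLoad (y i) a b e := by
        intro a b
        simp only [pairLoad]
        rw [Finset.sum_comm]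
        refine Finset.sum_congr rfl fun P _ => ?_
        split_ifs <;> simp
      simp only [load_eq_sum_pairLoad, h2]
      simp_rw [Finset.sum_comm (t := (Finset.univ : Finset I))]
    rw [h1]
    refine Finset.sum_le_sum fun i _ => ?_
    rw [Finset.sum_eq_single (s i), Finset.sum_eq_single (t i)]
    · simp only [pairLoad, y, true_and, hiff, ← ite_and]
      rw [Finset.sum_eq_single (w i).toPath]
      · split_ifs with h1 h2
        · exact le_rfl
        · exact absurd (SimpleGraph.Walk.edges_bypass_subset_edges _ h1.1) h2
        · exact bot_le
        · exact bot_le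
      · intro P _ hP
        simp [hP]
      · simp
    · intro b _ hb
      exact Finset.sum_eq_zero fun P _ => by simp [y, hb.symm]
    · simp
    · intro a _ ha
      exact Finset.sum_eq_zero fun b _ => Finset.sum_eq_zero fun P _ => by simp [y, ha.symm]
    · simp

open scoped Classical in
theorem load_serve_unitDemands {I : Type*} [Fintype I] (S : ObliviousScheme G K) (s t : I → K)
    (e : G.edgeSet) :
    load (S.serve (unitDemands s t)) e = ∑ i, pairLoad S.flow (s i) (t i) e := by
  rw [load_serve]
  simp only [unitDemands, Finset.sum_mul, ite_mul, one_mul, zero_mul]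
  have : ∀ F : K → K → I → ℝ≥0, ∑ a, ∑ b, ∑ i, F a b i = ∑ i, ∑ a, ∑ b, F a b i := by
    intro F
    simp_rw [Finset.sum_comm (t := (Finset.univ : Finset I))]
  rw [this]
  refine Finset.sum_congr rfl fun i _ => ?_
  simp [ite_and]

/-- The demand must leave `a` through the cut around it, whose capacity is at most the total
capacity `W`. Dividing by `W + 1` also covers `W = 0`. -/
theorem optCongestion_pos {cap : G.edgeSet → ℝ≥0} {d : Demand K} {a b : K} (hab : a ≠ b)
    (hd : 0 < d a b) : 0 < optCongestion cap d := by
  classical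
  set W : ℝ≥0 := ∑ e : G.edgeSet, cap e with hW
  have hpos : 0 < d a b / (W + 1) := by positivity
  refine lt_of_lt_of_le (ENNReal.coe_pos.2 hpos) (le_iInf fun x => le_iInf fun hx => ?_)
  by_contra hlt
  push Not at hlt
  lift congestion cap x to ℝ≥0 using (hlt.trans ENNReal.coe_lt_top).ne with t ht
  rw [ENNReal.coe_lt_coe, lt_div_iff₀ (by positivity)] at hlt
  have h1 := sum_demand_le_sum_load hx {(a : V)}
  have h2 : d a b ≤ ∑ a' : K, ∑ b' : K,
      if ¬((a' : V) ∈ ({(a : V)} : Set V) ↔ (b' : V) ∈ ({(a : V)} : Set V)) then d a' b' else 0 := by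
    refine le_trans ?_ (Finset.single_le_sum (fun _ _ => bot_le) (Finset.mem_univ a))
    refine le_trans ?_ (Finset.single_le_sum (fun _ _ => bot_le) (Finset.mem_univ b))
    have : (b : V) ≠ a := fun h => hab (Subtype.ext h.symm)
    simp [this]
  have h3 : ∑ e : G.edgeSet, (if Crosses {(a : V)} e then load x e else 0) ≤ t * W := by
    rw [hW, Finset.mul_sum]
    refine Finset.sum_le_sum fun e _ => ?_
    split_ifs
    · exact load_le_of_congestion_le ht.ge e
    · exact bot_le
  have h4 : t * W ≤ t * (W + 1) := by gcongr; exact le_self_add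
  exact absurd hlt (not_lt.2 ((h2.trans (h1.trans h3)).trans h4))

theorem load_le_congestion_one (x : MultiFlow G K) (e : G.edgeSet) :
    (load x e : ℝ≥0∞) ≤ congestion (fun _ => 1) x := by
  refine le_trans ?_ (le_iSup (fun e : G.edgeSet => (load x e : ℝ≥0∞) / ((1 : ℝ≥0) : ℝ≥0∞)) e)
  simp

end WalkFlows

/-! ### The diamond graph and its tent functions. -/

section Diamond

/-- The vertices of the diamond graph that is obtained from `2 ^ H` strands of length `2 ^ H`:
`node p b` is the point at position `p` of strand `b`. Two strands meet at a position `p` if they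
agree up to their last `i` binary digits for some `2 ^ i` that divides `p`. -/
structure DiamondNodes (H : ℕ) (V : Type*) where
  node : ℕ → ℕ → V
  surj : ∀ v, ∃ p ≤ 2 ^ H, ∃ b < 2 ^ H, node p b = v
  eq_iff : ∀ {p b p' b' : ℕ}, p ≤ 2 ^ H → b < 2 ^ H → p' ≤ 2 ^ H → b' < 2 ^ H →
    (node p b = node p' b' ↔ p = p' ∧ ∃ i, 2 ^ i ∣ p ∧ b / 2 ^ i = b' / 2 ^ i)

theorem div_two_pow_eq_of_le {b b' i j : ℕ} (hij : i ≤ j) (h : b / 2 ^ i = b' / 2 ^ i) :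
    b / 2 ^ j = b' / 2 ^ j := by
  obtain ⟨k, rfl⟩ := Nat.exists_eq_add_of_le hij
  rw [pow_add, ← Nat.div_div_eq_div_mul, ← Nat.div_div_eq_div_mul, h]

theorem exists_diamondNodes (H : ℕ) : ∃ n : ℕ, Nonempty (DiamondNodes H (Fin n)) := by
  classical
  let st : Setoid (ℕ × ℕ) :=
    { r := fun x y => x.1 = y.1 ∧ ∃ i, 2 ^ i ∣ x.1 ∧ x.2 / 2 ^ i = y.2 / 2 ^ i
      iseqv := by
        refine ⟨fun x => ⟨rfl, 0, by simp, rfl⟩, ?_, ?_⟩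
        · rintro x y ⟨h, i, hi, hb⟩
          exact ⟨h.symm, i, h ▸ hi, hb.symm⟩
        · rintro x y z ⟨h, i, hi, hb⟩ ⟨h', j, hj, hb'⟩
          rcases le_total i j with hij | hij
          · exact ⟨h.trans h', j, h ▸ hj, (div_two_pow_eq_of_le hij hb).trans hb'⟩
          · exact ⟨h.trans h', i, hi, hb.trans (div_two_pow_eq_of_le hij hb')⟩ }
  let W : Finset (Quotient st) :=
    (Finset.range (2 ^ H + 1) ×ˢ Finset.range (2 ^ H)).image fun x => Quotient.mk st x
  have hW : ∀ {p b : ℕ}, p ≤ 2 ^ H → b < 2 ^ H → Quotient.mk st (p, b) ∈ W := by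
    intro p b hp hb
    refine Finset.mem_image_of_mem (fun x => Quotient.mk st x) ?_
    simp only [Finset.mem_product, Finset.mem_range]
    exact ⟨Nat.lt_succ_of_le hp, hb⟩
  -- Default value for indices out of range.
  let w₀ : W := ⟨_, hW (Nat.zero_le _) (Nat.two_pow_pos H)⟩
  let node : ℕ → ℕ → Fin (Fintype.card W) := fun p b =>
    Fintype.equivFin W (if h : Quotient.mk st (p, b) ∈ W then ⟨_, h⟩ else w₀)
  have hnode : ∀ {p b : ℕ} (hp : p ≤ 2 ^ H) (hb : b < 2 ^ H),
      node p b = Fintype.equivFin W ⟨_, hW hp hb⟩ := by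
    intro p b hp hb
    simp only [node, dif_pos (hW hp hb)]
  refine ⟨_, ⟨node, fun v => ?_, fun {p b p' b'} hp hb hp' hb' => ?_⟩⟩
  · obtain ⟨⟨q, hq⟩, rfl⟩ := (Fintype.equivFin W).surjective v
    obtain ⟨x, hx, rfl⟩ := Finset.mem_image.1 hq
    simp only [Finset.mem_product, Finset.mem_range] at hx
    exact ⟨x.1, Nat.le_of_lt_succ hx.1, x.2, hx.2, hnode (Nat.le_of_lt_succ hx.1) hx.2⟩
  · rw [hnode hp hb, hnode hp' hb', (Fintype.equivFin W).injective.eq_iff, Subtype.mk.injEq]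
    exact Quotient.eq

variable {H : ℕ} {V : Type*} (D : DiamondNodes H V)

namespace DiamondNodes

/-- The edge of strand `b` from position `c` to position `c + 1`. -/
def edge (b c : ℕ) : Sym2 V := s(D.node c b, D.node (c + 1) b)

theorem node_eq {p b b' i : ℕ} (hp : p ≤ 2 ^ H) (hb : b < 2 ^ H) (hb' : b' < 2 ^ H)
    (hi : 2 ^ i ∣ p) (h : b / 2 ^ i = b' / 2 ^ i) : D.node p b = D.node p b' :=
  (D.eq_iff hp hb hp hb').2 ⟨rfl, i, hi, h⟩

/-- One of `c` and `c + 1` is odd, and distinct strands do not meet at odd positions. -/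
theorem edge_inj {b c b' c' : ℕ} (hb : b < 2 ^ H) (hc : c < 2 ^ H) (hb' : b' < 2 ^ H)
    (hc' : c' < 2 ^ H) : D.edge b c = D.edge b' c' ↔ b = b' ∧ c = c' := by
  refine ⟨fun h => ?_, by rintro ⟨rfl, rfl⟩; rfl⟩
  rw [edge, edge, Sym2.eq_iff] at h
  rcases h with ⟨h1, h2⟩ | ⟨h1, h2⟩
  · rw [D.eq_iff hc.le hb hc'.le hb'] at h1
    rw [D.eq_iff hc hb hc' hb'] at h2
    obtain ⟨rfl, i, hi, hbi⟩ := h1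
    obtain ⟨-, j, hj, hbj⟩ := h2
    refine ⟨?_, rfl⟩
    rcases i with _ | i
    · simpa using hbi
    rcases j with _ | j
    · simpa using hbj
    have h3 : 2 ∣ c := (dvd_pow_self 2 (Nat.succ_ne_zero i)).trans hi
    have h4 : 2 ∣ c + 1 := (dvd_pow_self 2 (Nat.succ_ne_zero j)).trans hj
    omega
  · rw [D.eq_iff hc.le hb hc' hb'] at h1
    rw [D.eq_iff hc hb hc'.le hb'] at h2
    omega

/-- The diamond graph. -/
def graph : SimpleGraph V where
  Adj u v := ∃ b < 2 ^ H, ∃ c < 2 ^ H, s(u, v) = D.edge b c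
  symm := ⟨fun u v h => by rwa [Sym2.eq_swap]⟩
  loopless := ⟨fun v ⟨b, hb, c, hc, h⟩ => by
    rw [edge, Sym2.eq_iff] at h
    have h1 : D.node c b = D.node (c + 1) b := by
      rcases h with ⟨h1, h2⟩ | ⟨h1, h2⟩
      exacts [h1.symm.trans h2, h2.symm.trans h1]
    rw [D.eq_iff hc.le hb hc hb] at h1
    omega⟩

theorem edge_mem {b c : ℕ} (hb : b < 2 ^ H) (hc : c < 2 ^ H) : D.edge b c ∈ D.graph.edgeSet :=
  (SimpleGraph.mem_edgeSet D.graph).2 ⟨b, hb, c, hc, rfl⟩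

theorem exists_eq_edge {e : Sym2 V} (he : e ∈ D.graph.edgeSet) :
    ∃ b < 2 ^ H, ∃ c < 2 ^ H, e = D.edge b c := by
  induction e using Sym2.ind with
  | _ u v => exact he

theorem exists_strand_walk {b p : ℕ} (hb : b < 2 ^ H) (n : ℕ) (hn : p + n ≤ 2 ^ H) :
    ∃ w : D.graph.Walk (D.node p b) (D.node (p + n) b),
      ∀ e ∈ w.edges, ∃ c, p ≤ c ∧ c < p + n ∧ e = D.edge b c := by
  induction n with
  | zero => exact ⟨SimpleGraph.Walk.nil, by simp⟩
  | succ n ih =>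
    obtain ⟨w, hw⟩ := ih (by omega)
    have hadj : D.graph.Adj (D.node (p + n) b) (D.node (p + (n + 1)) b) :=
      ⟨b, hb, p + n, by omega, rfl⟩
    refine ⟨w.concat hadj, fun e he => ?_⟩
    rw [SimpleGraph.Walk.edges_concat, List.concat_eq_append, List.mem_append,
      List.mem_singleton] at he
    rcases he with he | rfl
    · obtain ⟨c, h1, h2, h3⟩ := hw e he
      exact ⟨c, h1, by omega, h3⟩
    · exact ⟨p + n, by omega, by omega, rfl⟩

theorem connected : D.graph.Connected := by
  have hpos := Nat.two_pow_pos H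
  have h0 : ∀ v, D.graph.Reachable (D.node 0 0) v := by
    intro v
    obtain ⟨p, hp, b, hb, rfl⟩ := D.surj v
    rw [D.node_eq (i := H) (Nat.zero_le _) hpos hb (dvd_zero _) (by
      rw [Nat.div_eq_of_lt hpos, Nat.div_eq_of_lt hb])]
    obtain ⟨w, -⟩ := D.exists_strand_walk (p := 0) hb p (by omega)
    rw [zero_add] at w
    exact ⟨w⟩
  have : Nonempty V := ⟨D.node 0 0⟩
  exact SimpleGraph.Connected.mk fun u v => (h0 u).symm.trans (h0 v)

theorem two_pow_le_card [Fintype V] (D : DiamondNodes H V) : 2 ^ H ≤ Fintype.card V := by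
  have := Finset.card_le_card_of_injOn (s := Finset.range (2 ^ H)) (t := (Finset.univ : Finset V))
    (D.node 1) (fun _ _ => Finset.mem_coe.2 (Finset.mem_univ _)) (by
      intro b hb b' hb' h
      rw [Finset.coe_range, Set.mem_Iio] at hb hb'
      rw [D.eq_iff Nat.one_le_two_pow hb Nat.one_le_two_pow hb'] at h
      obtain ⟨-, i, hi, h⟩ := h
      rw [Nat.dvd_one.1 hi] at h
      simpa using h)
  simpa using this

end DiamondNodes

/-- The other child of the parent of `β` in the binary tree. -/
def sibling (β : ℕ) : ℕ := if β % 2 = 0 then β + 1 else β - 1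

theorem sibling_div_two (β : ℕ) : sibling β / 2 = β / 2 := by
  unfold sibling; split_ifs <;> omega

theorem sibling_ne (β : ℕ) : sibling β ≠ β := by
  unfold sibling; split_ifs <;> omega

theorem mul_add_div_two_pow {β m r : ℕ} (hr : r < 2 ^ m) : (β * 2 ^ m + r) / 2 ^ m = β := by
  rw [mul_comm, Nat.mul_add_div (Nat.two_pow_pos m), Nat.div_eq_of_lt hr, add_zero]

theorem div_two_pow_succ (b m : ℕ) : b / 2 ^ (m + 1) = b / 2 ^ m / 2 := by
  rw [pow_succ, Nat.div_div_eq_div_mul]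

theorem mul_add_lt_two_pow {β m r : ℕ} (hm : m < H) (hβ : β < 2 ^ (H - m)) (hr : r < 2 ^ m) :
    β * 2 ^ m + r < 2 ^ H := by
  calc β * 2 ^ m + r < (β + 1) * 2 ^ m := by rw [add_mul, one_mul]; omega
    _ ≤ 2 ^ (H - m) * 2 ^ m := Nat.mul_le_mul_right _ hβ
    _ = 2 ^ H := by rw [← pow_add]; congr 1; omega

theorem sibling_lt {β n : ℕ} (hn : 0 < n) (hβ : β < 2 ^ n) : sibling β < 2 ^ n := by
  obtain ⟨n, rfl⟩ := Nat.exists_eq_succ_of_ne_zero hn.ne'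
  rw [pow_succ] at *
  unfold sibling; split_ifs <;> omega

namespace DiamondNodes

/-- The middle of the strands `b` with `b / 2 ^ m = β` between the positions `C * 2 ^ (m + 1)` and
`(C + 1) * 2 ^ (m + 1)`. -/
def mid (m β C : ℕ) : V := D.node ((2 * C + 1) * 2 ^ m) (β * 2 ^ m)

theorem mid_pos_le {m C : ℕ} (hm : m < H) (hC : C < 2 ^ (H - m - 1)) :
    (2 * C + 2) * 2 ^ m ≤ 2 ^ H := by
  calc (2 * C + 2) * 2 ^ m = (C + 1) * (2 * 2 ^ m) := by ring
    _ ≤ 2 ^ (H - m - 1) * (2 * 2 ^ m) := Nat.mul_le_mul_right _ hC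
    _ = 2 ^ H := by
      rw [← pow_succ', ← pow_add]; congr 1; omega

theorem mid_eq {m β C r : ℕ} (hm : m < H) (hC : C < 2 ^ (H - m - 1)) (hβ : β < 2 ^ (H - m))
    (hr : r < 2 ^ m) : D.mid m β C = D.node ((2 * C + 1) * 2 ^ m) (β * 2 ^ m + r) := by
  refine D.node_eq (i := m) ?_ ?_ (mul_add_lt_two_pow hm hβ hr) (Dvd.intro_left _ rfl) ?_
  · refine le_trans (Nat.mul_le_mul_right _ ?_) (mid_pos_le hm hC)
    omega
  · exact mul_add_lt_two_pow (r := 0) hm hβ (Nat.two_pow_pos m)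
  · rw [mul_add_div_two_pow hr, ← add_zero (β * 2 ^ m), mul_add_div_two_pow (Nat.two_pow_pos m)]

theorem le_of_two_pow_dvd {i m C : ℕ} (h : 2 ^ i ∣ (2 * C + 1) * 2 ^ m) : i ≤ m := by
  by_contra hlt
  have h1 : 2 * 2 ^ m ∣ (2 * C + 1) * 2 ^ m := by
    rw [← pow_succ']
    exact (pow_dvd_pow 2 (by omega)).trans h
  have := Nat.dvd_of_mul_dvd_mul_right (Nat.two_pow_pos m) h1
  omega

theorem mid_ne_mid_sibling {m β C : ℕ} (hm : m < H) (hC : C < 2 ^ (H - m - 1))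
    (hβ : β < 2 ^ (H - m)) : D.mid m β C ≠ D.mid m (sibling β) C := by
  intro h
  have hp : (2 * C + 1) * 2 ^ m ≤ 2 ^ H :=
    le_trans (Nat.mul_le_mul_right _ (by omega)) (mid_pos_le hm hC)
  have h1 := mul_add_lt_two_pow (r := 0) hm hβ (Nat.two_pow_pos m)
  have h2 := mul_add_lt_two_pow (r := 0) hm (sibling_lt (by omega) hβ) (Nat.two_pow_pos m)
  rw [add_zero] at h1 h2
  rw [mid, mid, D.eq_iff hp h1 hp h2] at h
  obtain ⟨-, i, hi, h⟩ := h
  have h3 := div_two_pow_eq_of_le (le_of_two_pow_dvd hi) h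
  rw [Nat.mul_div_cancel _ (Nat.two_pow_pos m), Nat.mul_div_cancel _ (Nat.two_pow_pos m)] at h3
  exact sibling_ne β h3.symm

/-- Two adjacent middles are joined through one half of the strands, by walks that use one strand
on either side. -/
theorem exists_walk_mid {m β γ r : ℕ} (hm : m < H) (hγ : γ < 2 ^ (H - m)) (hβ : β < 2 ^ (H - m))
    (hr : r < 2 ^ m) :
    ∃ w : D.graph.Walk (D.mid m β (γ / 2)) (D.mid m (sibling β) (γ / 2)), ∀ e ∈ w.edges,
      ∃ b < 2 ^ H, ∃ c < 2 ^ H, b % 2 ^ m = r ∧ c / 2 ^ m = γ ∧ e = D.edge b c := by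
  have hβ' : sibling β < 2 ^ (H - m) := sibling_lt (by omega) hβ
  have hC : γ / 2 < 2 ^ (H - m - 1) := by
    rw [Nat.div_lt_iff_lt_mul two_pos, ← pow_succ]
    convert hγ using 2
    omega
  have hend : γ * 2 ^ m + 2 ^ m ≤ 2 ^ H := by
    have := mul_add_lt_two_pow (r := 2 ^ m - 1) hm hγ (by have := Nat.two_pow_pos m; omega)
    have := Nat.two_pow_pos m
    omega
  have hb₁ := mul_add_lt_two_pow hm hβ hr
  have hb₂ := mul_add_lt_two_pow hm hβ' hr
  obtain ⟨w₁, h₁⟩ := D.exists_strand_walk hb₁ (2 ^ m) hend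
  obtain ⟨w₂, h₂⟩ := D.exists_strand_walk hb₂ (2 ^ m) hend
  rw [D.mid_eq hm hC hβ hr, D.mid_eq hm hC hβ' hr]
  have hgood : ∀ {β' : ℕ} {e : Sym2 V}, β' < 2 ^ (H - m) →
      (∃ c, γ * 2 ^ m ≤ c ∧ c < γ * 2 ^ m + 2 ^ m ∧ e = D.edge (β' * 2 ^ m + r) c) →
      ∃ b < 2 ^ H, ∃ c < 2 ^ H, b % 2 ^ m = r ∧ c / 2 ^ m = γ ∧ e = D.edge b c := by
    rintro β' e h ⟨c, hc1, hc2, rfl⟩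
    refine ⟨_, mul_add_lt_two_pow hm h hr, c, by omega, ?_, ?_, rfl⟩
    · rw [mul_comm, Nat.mul_add_mod, Nat.mod_eq_of_lt hr]
    · exact Nat.div_eq_of_lt_le hc1 (by rw [add_mul, one_mul]; exact hc2)
  have hdiv : (β * 2 ^ m + r) / 2 ^ (m + 1) = (sibling β * 2 ^ m + r) / 2 ^ (m + 1) := by
    rw [div_two_pow_succ, div_two_pow_succ, mul_add_div_two_pow hr, mul_add_div_two_pow hr,
      sibling_div_two]
  -- For even `γ` the walks use the left half of the diamond and meet at its left end; for odd `γ`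
  -- they meet at the right end. Both ends are multiples of `2 ^ (m + 1)`.
  rcases Nat.even_or_odd' γ with ⟨C, rfl | rfl⟩
  · have hmid : (2 * (2 * C / 2) + 1) * 2 ^ m = 2 * C * 2 ^ m + 2 ^ m := by
      rw [Nat.mul_div_cancel_left _ two_pos]
      ring
    have hmeet : D.node (2 * C * 2 ^ m) (β * 2 ^ m + r) =
        D.node (2 * C * 2 ^ m) (sibling β * 2 ^ m + r) :=
      D.node_eq (i := m + 1) (by omega) hb₁ hb₂ ⟨C, by ring⟩ hdiv
    rw [hmid]
    refine ⟨w₁.reverse.append (w₂.copy hmeet.symm rfl), fun e he => ?_⟩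
    simp only [SimpleGraph.Walk.edges_append, SimpleGraph.Walk.edges_copy,
      SimpleGraph.Walk.edges_reverse, List.mem_append, List.mem_reverse] at he
    rcases he with he | he
    exacts [hgood hβ (h₁ e he), hgood hβ' (h₂ e he)]
  · have hmid : (2 * ((2 * C + 1) / 2) + 1) * 2 ^ m = (2 * C + 1) * 2 ^ m := by
      congr 1
      omega
    have hmeet : D.node ((2 * C + 1) * 2 ^ m + 2 ^ m) (β * 2 ^ m + r) =
        D.node ((2 * C + 1) * 2 ^ m + 2 ^ m) (sibling β * 2 ^ m + r) :=
      D.node_eq (i := m + 1) hend hb₁ hb₂ ⟨C + 1, by ring⟩ hdiv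
    rw [hmid]
    refine ⟨w₁.append (w₂.reverse.copy hmeet.symm rfl), fun e he => ?_⟩
    simp only [SimpleGraph.Walk.edges_append, SimpleGraph.Walk.edges_copy,
      SimpleGraph.Walk.edges_reverse, List.mem_append, List.mem_reverse] at he
    rcases he with he | he
    exacts [hgood hβ (h₁ e he), hgood hβ' (h₂ e he)]

/-- The tent of height `2 ^ m` around the point `mid m β C`. -/
def tent (m β C p b : ℕ) : ℤ :=
  if b / 2 ^ m = β then max 0 (2 ^ m - |(p : ℤ) - (2 * C + 1) * 2 ^ m|) else 0

/-- This makes the tent a function of the vertex: strands that meet at `p` either agree in their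
block at scale `m`, or `p` is a multiple of `2 ^ (m + 1)`, where the tent is zero. -/
theorem tent_congr {m β C p b b' i : ℕ} (hi : 2 ^ i ∣ p) (h : b / 2 ^ i = b' / 2 ^ i) :
    tent m β C p b = tent m β C p b' := by
  rcases le_or_gt i m with him | him
  · rw [tent, tent, div_two_pow_eq_of_le him h]
  · have hdvd : (2 * 2 ^ m : ℕ) ∣ p := by
      rw [← pow_succ']
      exact (pow_dvd_pow 2 him).trans hi
    obtain ⟨q, rfl⟩ := hdvd
    have h0 : max 0 ((2 : ℤ) ^ m - |((2 * 2 ^ m * q : ℕ) : ℤ) - (2 * C + 1) * 2 ^ m|) = 0 := by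
      refine max_eq_left ?_
      have h1 : ((2 * 2 ^ m * q : ℕ) : ℤ) - (2 * C + 1) * 2 ^ m = (2 * (q - C) - 1) * 2 ^ m := by
        push_cast; ring
      have h2 : (1 : ℤ) ≤ |2 * ((q : ℤ) - C) - 1| := Int.one_le_abs (by omega)
      have h3 : (0 : ℤ) < 2 ^ m := by positivity
      rw [h1, abs_mul, abs_of_pos h3]
      nlinarith
    simp only [tent, h0, ite_self]

theorem abs_tent_sub_le (m β C c b : ℕ) : |tent m β C c b - tent m β C (c + 1) b| ≤
    if b / 2 ^ m = β ∧ c / 2 ^ (m + 1) = C then 1 else 0 := by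
  by_cases hb : b / 2 ^ m = β
  · simp only [tent, hb, if_true, true_and]
    have h2 : (0 : ℤ) < 2 ^ m := by positivity
    have hiff : c / 2 ^ (m + 1) = C ↔ (2 * C + 1) * 2 ^ m - 2 ^ m ≤ (c : ℤ) ∧
        (c : ℤ) + 1 ≤ (2 * C + 1) * 2 ^ m + 2 ^ m := by
      have h3 : c / 2 ^ (m + 1) = C ↔ C * 2 ^ (m + 1) ≤ c ∧ c < (C + 1) * 2 ^ (m + 1) := by
        have := Nat.two_pow_pos (m + 1)
        rw [Nat.div_eq_iff this, add_mul]
        omega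
      rw [h3]
      zify
      rw [pow_succ, Int.lt_iff_add_one_le]
      constructor
      · rintro ⟨h5, h6⟩
        constructor <;> linarith
      · rintro ⟨h5, h6⟩
        constructor <;> linarith
    simp only [hiff]
    push_cast
    generalize (2 * (C : ℤ) + 1) * 2 ^ m = p₀
    generalize (2 : ℤ) ^ m = h at h2
    generalize (c : ℤ) = x
    split_ifs with hx
    · grind
    · grind
  · simp [tent, hb]

end DiamondNodes

end Diamond

/-! ### The lower bound on diamond graphs. -/

section DiamondLowerBound

namespace DiamondNodes

variable {H : ℕ} {V : Type*} (D : DiamondNodes H V)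

open scoped Classical in
/-- A path between adjacent middles descends the tent around its first end. -/
theorem two_pow_le_card_edges {m β C : ℕ} (hm : m < H) (hC : C < 2 ^ (H - m - 1))
    (hβ : β < 2 ^ (H - m)) {u v : V} (hu : u = D.mid m β C) (hv : v = D.mid m (sibling β) C)
    (P : D.graph.Path u v) :
    2 ^ m ≤ (Finset.univ.filter fun x : Fin (2 ^ H) × Fin (2 ^ H) =>
      ((x.1 : ℕ) / 2 ^ m = β ∧ (x.2 : ℕ) / 2 ^ (m + 1) = C) ∧
        D.edge x.1 x.2 ∈ P.1.edges).card := by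
  choose p hp b hb hpb using D.surj
  set φ : V → ℤ := fun v => tent m β C (p v) (b v) with hφ
  have hφnode : ∀ {q a : ℕ}, q ≤ 2 ^ H → a < 2 ^ H → φ (D.node q a) = tent m β C q a := by
    intro q a hq ha
    obtain ⟨h1, i, hi, h2⟩ := (D.eq_iff (hp _) (hb _) hq ha).1 (hpb (D.node q a))
    simp only [hφ]
    rw [tent_congr hi h2, h1]
  set T : Finset (Fin (2 ^ H) × Fin (2 ^ H)) := Finset.univ.filter fun x =>
    (x.1 : ℕ) / 2 ^ m = β ∧ (x.2 : ℕ) / 2 ^ (m + 1) = C with hT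
  -- On an edge of the graph, 1 inside the cell of the tent and 0 elsewhere: a bound for the slope
  -- of `φ`.
  set ω : Sym2 V → ℤ := fun e => ∑ x ∈ T, if D.edge x.1 x.2 = e then 1 else 0 with hω
  have hstep : ∀ u v, D.graph.Adj u v → |φ u - φ v| ≤ ω s(u, v) := by
    rintro u v ⟨a, ha, c, hc, h⟩
    have h1 : |φ u - φ v| = |tent m β C c a - tent m β C (c + 1) a| := by
      rw [← hφnode hc.le ha, ← hφnode hc ha]
      rw [edge, Sym2.eq_iff] at h
      rcases h with ⟨rfl, rfl⟩ | ⟨rfl, rfl⟩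
      exacts [rfl, abs_sub_comm _ _]
    rw [h1, h]
    refine (abs_tent_sub_le m β C c a).trans ?_
    have h0 : ∀ x ∈ T, (0 : ℤ) ≤ if D.edge x.1 x.2 = D.edge a c then 1 else 0 :=
      fun x _ => by split_ifs <;> norm_num
    split_ifs with hac
    · have hmem : ((⟨a, ha⟩, ⟨c, hc⟩) : Fin (2 ^ H) × Fin (2 ^ H)) ∈ T :=
        Finset.mem_filter.2 ⟨Finset.mem_univ _, hac⟩
      refine le_trans ?_ (Finset.single_le_sum h0 hmem)
      simp
    · exact Finset.sum_nonneg h0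
  have hmain := abs_sub_le_sum_edges hstep P.1
  have hpos : (2 * C + 1) * 2 ^ m ≤ 2 ^ H :=
    le_trans (Nat.mul_le_mul_right _ (by omega)) (mid_pos_le hm hC)
  have h1 := mul_add_lt_two_pow (r := 0) hm hβ (Nat.two_pow_pos m)
  have h2 := mul_add_lt_two_pow (r := 0) hm (sibling_lt (by omega) hβ) (Nat.two_pow_pos m)
  rw [add_zero] at h1 h2
  have hφu : φ u = 2 ^ m := by
    rw [hu, mid, hφnode hpos h1, tent, Nat.mul_div_cancel _ (Nat.two_pow_pos m), if_pos rfl]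
    push_cast
    simp
  have hφv : φ v = 0 := by
    rw [hv, mid, hφnode hpos h2, tent, Nat.mul_div_cancel _ (Nat.two_pow_pos m),
      if_neg (sibling_ne β)]
  have hsum : (P.1.edges.map ω).sum =
      ((T.filter fun x => D.edge x.1 x.2 ∈ P.1.edges).card : ℤ) := by
    rw [← List.sum_toFinset _ P.2.isTrail.edges_nodup, hω, Finset.sum_comm,
      Finset.card_filter]
    push_cast
    refine Finset.sum_congr rfl fun x _ => ?_
    simp
  rw [hφu, hφv, hsum, sub_zero, abs_of_pos (by positivity), hT, Finset.filter_filter] at hmain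
  exact_mod_cast hmain

open scoped Classical in
/-- The middles of the `h` coarsest levels. -/
def terminals (h : ℕ) : Finset V :=
  (Finset.range h).biUnion fun i =>
    (Finset.range (2 ^ (i + 1)) ×ˢ Finset.range (2 ^ i)).image fun y => D.mid (H - 1 - i) y.1 y.2

theorem mid_mem_terminals {h i β C : ℕ} (hi : i < h) (hβ : β < 2 ^ (i + 1)) (hC : C < 2 ^ i) :
    D.mid (H - 1 - i) β C ∈ D.terminals h := by
  classical
  refine Finset.mem_biUnion.2 ⟨i, Finset.mem_range.2 hi, Finset.mem_image.2 ⟨(β, C), ?_, rfl⟩⟩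
  simp [hβ, hC]

theorem four_mul_card_terminals_le {h : ℕ} (hh : 1 ≤ h) : 4 * (D.terminals h).card ≤ 8 ^ h := by
  classical
  have h1 : (D.terminals h).card ≤ ∑ i ∈ Finset.range h, 2 ^ (i + 1) * 2 ^ i := by
    refine Finset.card_biUnion_le.trans (Finset.sum_le_sum fun i _ => ?_)
    refine Finset.card_image_le.trans_eq ?_
    simp
  have h2 : 4 * ∑ i ∈ Finset.range h, 2 ^ (i + 1) * 2 ^ i ≤ 8 ^ h := by
    clear h1
    induction h, hh using Nat.le_induction with
    | base => simp
    | succ n hn ih =>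
      rw [Finset.sum_range_succ, mul_add, pow_succ 8]
      have h3 : 2 ^ (n + 1) * 2 ^ n = 2 * 4 ^ n := by
        rw [pow_succ, mul_right_comm, ← mul_pow]; ring
      have h4 : 2 * 4 ^ n ≤ 8 ^ n := by
        obtain ⟨k, rfl⟩ := Nat.exists_eq_add_of_le' hn
        have : 4 ^ k ≤ 8 ^ k := Nat.pow_le_pow_left (by norm_num) k
        rw [pow_succ, pow_succ]
        omega
      omega
  omega

variable [Fintype V]

/-- The demand is found by averaging the load of the edge `x` under the demand `dem x` over all `4 ^
H` edges. Level `i` counts from the coarsest scale, so `m = H - 1 - i`. -/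
theorem exists_costly_demand {h : ℕ} (hh : 1 ≤ h) (hH : h ≤ H) {K : Finset V}
    (hK : D.terminals h ⊆ K) (S : ObliviousScheme D.graph K) :
    ∃ d : Demand K, 0 < optCongestion (fun _ : D.graph.edgeSet => 1) d ∧
      optCongestion (fun _ : D.graph.edgeSet => 1) d ≤ 1 ∧
      ((h / 2 : ℝ≥0) : ℝ≥0∞) ≤ congestion (fun _ => 1) (S.serve d) := by
  classical
  have hm : ∀ i : Fin h, H - 1 - (i : ℕ) < H := fun i => by have := i.2; omega
  have hexp : ∀ i : Fin h, H - (H - 1 - (i : ℕ)) = i + 1 := fun i => by have := i.2; omega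
  have hexp' : ∀ i : Fin h, H - (H - 1 - (i : ℕ)) - 1 = i := fun i => by have := i.2; omega
  have hdiv : ∀ (i : Fin h) (b : Fin (2 ^ H)),
      (b : ℕ) / 2 ^ (H - 1 - (i : ℕ)) < 2 ^ ((i : ℕ) + 1) := by
    intro i b
    rw [Nat.div_lt_iff_lt_mul (Nat.two_pow_pos _), ← pow_add]
    refine b.2.trans_eq ?_
    congr 1
    have := i.2
    omega
  have hdiv' : ∀ (i : Fin h) (c : Fin (2 ^ H)),
      (c : ℕ) / 2 ^ (H - 1 - (i : ℕ) + 1) < 2 ^ (i : ℕ) := by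
    intro i c
    rw [Nat.div_lt_iff_lt_mul (Nat.two_pow_pos _), ← pow_add]
    refine c.2.trans_eq ?_
    congr 1
    have := i.2
    omega
  let A : (i : Fin h) → Fin (2 ^ ((i : ℕ) + 1)) × Fin (2 ^ (i : ℕ)) → K := fun i y =>
    ⟨D.mid (H - 1 - i) y.1 y.2, hK (D.mid_mem_terminals i.2 y.1.2 y.2.2)⟩
  let A' : (i : Fin h) → Fin (2 ^ ((i : ℕ) + 1)) × Fin (2 ^ (i : ℕ)) → K := fun i y =>
    ⟨D.mid (H - 1 - i) (sibling y.1) y.2,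
      hK (D.mid_mem_terminals i.2 (sibling_lt (Nat.succ_pos _) y.1.2) y.2.2)⟩
  let cell : (i : Fin h) → Fin (2 ^ H) × Fin (2 ^ H) →
      Fin (2 ^ ((i : ℕ) + 1)) × Fin (2 ^ (i : ℕ)) := fun i x => (⟨_, hdiv i x.1⟩, ⟨_, hdiv' i x.2⟩)
  let I : Type := Σ i : Fin h, Fin (2 ^ (H - 1 - (i : ℕ)))
  -- For each scale `m`, `2 ^ m` units between the opposite middles of the diamond that contains
  -- `x`.
  let dem : Fin (2 ^ H) × Fin (2 ^ H) → Demand K := fun x =>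
    unitDemands (fun j : I => A j.1 (cell j.1 x)) (fun j : I => A' j.1 (cell j.1 x))
  have hopt : ∀ x, optCongestion (fun _ : D.graph.edgeSet => 1) (dem x) ≤ 1 := by
    intro x
    have hwalk : ∀ j : I, ∃ w : D.graph.Walk (A j.1 (cell j.1 x) : V) (A' j.1 (cell j.1 x)),
        ∀ e ∈ w.edges, ∃ b : ℕ, b < 2 ^ H ∧ ∃ c < 2 ^ H,
          b % 2 ^ (H - 1 - (j.1 : ℕ)) = j.2 ∧
          c / 2 ^ (H - 1 - (j.1 : ℕ)) = sibling (x.2 / 2 ^ (H - 1 - (j.1 : ℕ))) ∧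
          e = D.edge b c := by
      intro j
      have := D.exists_walk_mid (hm j.1) (sibling_lt (by have := hm j.1; omega)
        (by rw [hexp]; exact hdiv j.1 x.2)) (by rw [hexp]; exact hdiv j.1 x.1) j.2.2
      rw [sibling_div_two, ← div_two_pow_succ] at this
      exact this
    choose w hw using hwalk
    obtain ⟨f, hf, hload⟩ := exists_flow_of_walks (fun j : I => A j.1 (cell j.1 x))
      (fun j : I => A' j.1 (cell j.1 x)) w
    refine (iInf₂_le f hf).trans ?_
    refine congestion_le_of_load_le (t := 1) fun e => (hload e).trans ?_
    rw [Finset.sum_boole, mul_one]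
    refine (Nat.cast_le.2 (Finset.card_le_one.2 ?_)).trans_eq Nat.cast_one
    obtain ⟨b, hb, c, hc, he⟩ := D.exists_eq_edge e.2
    have hspec : ∀ j : I, (e : Sym2 V) ∈ (w j).edges → b % 2 ^ (H - 1 - (j.1 : ℕ)) = j.2 ∧
          c / 2 ^ (H - 1 - (j.1 : ℕ)) = sibling (x.2 / 2 ^ (H - 1 - (j.1 : ℕ))) := by
      intro j hj
      obtain ⟨b', hb', c', hc', h1, h2, h3⟩ := hw j e hj
      rw [he, D.edge_inj hb hc hb' hc'] at h3
      rw [h3.1, h3.2]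
      exact ⟨h1, h2⟩
    -- The scale can be read off the edge: a walk of scale `m` stays at positions that part from
    -- that of `x` exactly at binary digit `m`.
    have hle : ∀ j j' : I, (e : Sym2 V) ∈ (w j).edges → (e : Sym2 V) ∈ (w j').edges →
        H - 1 - (j.1 : ℕ) ≤ H - 1 - (j'.1 : ℕ) := by
      intro j j' hj hj'
      by_contra hlt
      have h1 := (hspec j hj).2
      have h2 := congrArg (· / 2) (hspec j' hj').2
      simp only [sibling_div_two, ← div_two_pow_succ] at h2
      rw [div_two_pow_eq_of_le (by omega) h2] at h1
      exact sibling_ne _ h1.symm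
    rintro ⟨i, r⟩ hj ⟨i', r'⟩ hj'
    have hj := (Finset.mem_filter.1 hj).2
    have hj' := (Finset.mem_filter.1 hj').2
    have heq := le_antisymm (hle _ _ hj hj') (hle _ _ hj' hj)
    have hi : i = i' := Fin.ext (by
      have h1 := i.2
      have h2 := i'.2
      simp only at heq
      omega)
    subst hi
    have hr : r = r' := Fin.ext ((hspec _ hj).1.symm.trans (hspec _ hj').1)
    rw [hr]
  have hpos : ∀ x, 0 < optCongestion (fun _ : D.graph.edgeSet => 1) (dem x) := by
    intro x
    let j : I := ⟨⟨0, hh⟩, ⟨0, Nat.two_pow_pos _⟩⟩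
    refine optCongestion_pos (a := A j.1 (cell j.1 x)) (b := A' j.1 (cell j.1 x)) ?_ ?_
    · intro h
      exact D.mid_ne_mid_sibling (hm j.1) (by rw [hexp']; exact hdiv' j.1 x.2)
        (by rw [hexp]; exact hdiv j.1 x.1) (congrArg Subtype.val h)
    · simp only [dem, unitDemands]
      refine lt_of_lt_of_le ?_ (Finset.single_le_sum (fun _ _ => bot_le) (Finset.mem_univ j))
      simp
  let E : Fin (2 ^ H) × Fin (2 ^ H) → D.graph.edgeSet := fun x => ⟨_, D.edge_mem x.1.2 x.2.2⟩
  -- Every path between the two middles has at least `2 ^ m` edges in the cell, so the unit flow has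
  -- total load at least `2 ^ m` there.
  have hcell : ∀ (i : Fin h) (y : Fin (2 ^ ((i : ℕ) + 1)) × Fin (2 ^ (i : ℕ))),
      (2 : ℝ≥0) ^ (H - 1 - (i : ℕ)) ≤ ∑ x ∈ Finset.univ.filter (fun x => cell i x = y),
        pairLoad S.flow (A i y) (A' i y) (E x) := by
    intro i y
    have h1 : ∑ P : D.graph.Path (A i y : V) (A' i y), S.flow (A i y) (A' i y) P = 1 :=
      S.unit (A i y) (A' i y)
    simp only [pairLoad]
    rw [Finset.sum_comm, ← mul_one ((2 : ℝ≥0) ^ _), ← h1, Finset.mul_sum]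
    refine Finset.sum_le_sum fun P _ => ?_
    rw [← Finset.sum_filter, Finset.sum_const, nsmul_eq_mul, Finset.filter_filter]
    refine mul_le_mul_of_nonneg_right ?_ bot_le
    have h2 := D.two_pow_le_card_edges (hm i) (by rw [hexp']; exact y.2.2)
      (by rw [hexp]; exact y.1.2) rfl rfl P
    have h3 : ∀ x, cell i x = y ↔ (x.1 : ℕ) / 2 ^ (H - 1 - (i : ℕ)) = y.1 ∧
        (x.2 : ℕ) / 2 ^ (H - 1 - (i : ℕ) + 1) = y.2 := by
      intro x
      rw [Prod.ext_iff, Fin.ext_iff, Fin.ext_iff]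
    simp only [h3]
    exact_mod_cast h2
  -- There are `2 ^ (2 * i + 1)` cells, each contributing `2 ^ m * 2 ^ m`; as `m + i = H - 1`, this
  -- is `4 ^ H / 2`.
  have hlevel : ∀ i : Fin h, (2 : ℝ≥0) ^ H * 2 ^ H / 2 ≤ ∑ x, 2 ^ (H - 1 - (i : ℕ)) *
      pairLoad S.flow (A i (cell i x)) (A' i (cell i x)) (E x) := by
    intro i
    rw [← Finset.mul_sum, ← Finset.sum_fiberwise Finset.univ (cell i)]
    have h1 : ∀ y, (2 : ℝ≥0) ^ (H - 1 - (i : ℕ)) ≤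
        ∑ x ∈ Finset.univ.filter (fun x => cell i x = y),
          pairLoad S.flow (A i (cell i x)) (A' i (cell i x)) (E x) := by
      intro y
      refine (hcell i y).trans_eq (Finset.sum_congr rfl fun x hx => ?_)
      rw [(Finset.mem_filter.1 hx).2]
    refine le_trans (le_of_eq ?_) (mul_le_mul_of_nonneg_left (Finset.sum_le_sum fun y _ => h1 y)
      bot_le)
    simp only [Finset.sum_const, Finset.card_univ, Fintype.card_prod, Fintype.card_fin,
      nsmul_eq_mul]
    push_cast
    have h2 : H = H - 1 - (i : ℕ) + (i + 1) := by have := i.2; omega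
    have h3 : (2 : ℝ≥0) ^ H = 2 ^ (H - 1 - (i : ℕ)) * 2 ^ ((i : ℕ) + 1) := by
      rw [← pow_add, ← h2]
    rw [h3, pow_succ (2 : ℝ≥0) (i : ℕ)]
    field_simp
  have htotal : ∑ _x : Fin (2 ^ H) × Fin (2 ^ H), (h / 2 : ℝ≥0) ≤
      ∑ x, load (S.serve (dem x)) (E x) := by
    have h1 : ∀ x, load (S.serve (dem x)) (E x) = ∑ i : Fin h, 2 ^ (H - 1 - (i : ℕ)) *
        pairLoad S.flow (A i (cell i x)) (A' i (cell i x)) (E x) := by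
      intro x
      rw [load_serve_unitDemands, Fintype.sum_sigma]
      refine Finset.sum_congr rfl fun i _ => ?_
      simp
    simp only [h1]
    rw [Finset.sum_comm]
    refine le_trans (le_of_eq ?_) (Finset.sum_le_sum fun i _ => hlevel i)
    simp
    ring
  obtain ⟨x, -, hx⟩ := Finset.exists_le_of_sum_le
    ⟨(⟨0, Nat.two_pow_pos H⟩, ⟨0, Nat.two_pow_pos H⟩), Finset.mem_univ _⟩ htotal
  exact ⟨dem x, hpos x, hopt x,
    le_trans (by exact_mod_cast hx) (load_le_congestion_one (S.serve (dem x)) (E x))⟩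

end DiamondNodes

theorem log_le_twelve_mul_half_log {k : ℕ} (hk : 2 ≤ k) :
    1 / 12 * Real.log k ≤ (Nat.log 8 (4 * k) : ℝ) / 2 := by
  set h := Nat.log 8 (4 * k) with hh
  have h1 : 1 ≤ h := Nat.log_pos (by norm_num) (by omega)
  have h2 : 4 * k < 8 ^ (h + 1) := Nat.lt_pow_succ_log_self (by norm_num) _
  have h3 : (k : ℝ) ≤ 8 ^ (h + 1) := by
    have : k ≤ 8 ^ (h + 1) := by omega
    exact_mod_cast this
  have h4 : Real.log k ≤ (h + 1 : ℕ) * Real.log 8 := by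
    rw [← Real.log_pow]
    exact Real.log_le_log (by positivity) h3
  have h5 : Real.log 8 = 3 * Real.log 2 := by
    rw [show (8 : ℝ) = 2 ^ 3 by norm_num, Real.log_pow]
    norm_num
  have h6 := Real.log_two_lt_d9
  have h7 : (1 : ℝ) ≤ h := by exact_mod_cast h1
  push_cast at h4
  rw [h5] at h4
  nlinarith

/-- No oblivious routing scheme for the diamond graphs is better than `O(log k)`-competitive. -/
theorem exists_graph_forall_scheme {k : ℕ} (hk : 2 ≤ k) :
    ∃ (n : ℕ) (G : SimpleGraph (Fin n)) (c : G.edgeSet → ℝ≥0) (K : Finset (Fin n)),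
      G.Connected ∧ (∀ e, 0 < c e) ∧ K.card = k ∧
      ∀ S : ObliviousScheme G K, ∃ d : Demand K,
        0 < optCongestion c d ∧ optCongestion c d < ⊤ ∧
        ENNReal.ofReal (1 / 12 * Real.log k) * optCongestion c d ≤
          congestion c (S.serve d) := by
  -- Depth `k` provides at least `2 ^ k` vertices, enough to pad the middles of the `h` coarsest
  -- levels to exactly `k` terminals.
  obtain ⟨n, ⟨D⟩⟩ := exists_diamondNodes k
  set h := Nat.log 8 (4 * k) with hh
  have h1 : 1 ≤ h := Nat.log_pos (by norm_num) (by omega)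
  have h2 : 8 ^ h ≤ 4 * k := Nat.pow_log_le_self 8 (by omega)
  have h3 : h ≤ k := by
    by_contra hlt
    have h4 : 8 ^ (k + 1) ≤ 8 ^ h := Nat.pow_le_pow_right (by norm_num) (by omega)
    have h5 : k < 8 ^ k := Nat.lt_pow_self (by norm_num)
    rw [pow_succ] at h4
    omega
  obtain ⟨K, hK, hcard⟩ := Finset.exists_superset_card_eq (s := D.terminals h) (n := k)
    (by have := D.four_mul_card_terminals_le h1; omega)
    (Nat.lt_two_pow_self.le.trans (D.two_pow_le_card))
  refine ⟨n, D.graph, fun _ => 1, K, D.connected, fun _ => one_pos, hcard, fun S => ?_⟩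
  obtain ⟨d, hd0, hd1, hd⟩ := D.exists_costly_demand h1 h3 hK S
  refine ⟨d, hd0, hd1.trans_lt ENNReal.one_lt_top, le_trans ?_ hd⟩
  calc _ ≤ ENNReal.ofReal (1 / 12 * Real.log k) * 1 := by gcongr
    _ ≤ ENNReal.ofReal ((h : ℝ) / 2) := by
      rw [mul_one]
      exact ENNReal.ofReal_le_ofReal (log_le_twelve_mul_half_log hk)
    _ = _ := by
      rw [ENNReal.ofReal, ENNReal.coe_inj]
      ext
      rw [Real.coe_toNNReal _ (by positivity)]
      simp

end DiamondLowerBound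

end

end SteinerRouting

theorem mainTheorem6 :
    (∃ C : ℝ, 0 < C ∧
      ∀ (V : Type*) [Fintype V] (G : SimpleGraph V) (c : G.edgeSet → ℝ≥0) (K : Finset V),
        (∀ a ∈ K, ∀ b ∈ K, G.Reachable a b) →
        ∃ S : SteinerRouting.ObliviousScheme G K, ∀ d : SteinerRouting.Demand K,
          SteinerRouting.congestion c (S.serve d) ≤
            ENNReal.ofReal (C * Real.log K.card) * SteinerRouting.optCongestion c d) ∧
    (∃ C' : ℝ, 0 < C' ∧
      ∀ k : ℕ, 2 ≤ k →
        ∃ (n : ℕ) (G : SimpleGraph (Fin n)) (c : G.edgeSet → ℝ≥0) (K : Finset (Fin n)),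
          G.Connected ∧ (∀ e, 0 < c e) ∧ K.card = k ∧
          ∀ S : SteinerRouting.ObliviousScheme G K, ∃ d : SteinerRouting.Demand K,
            0 < SteinerRouting.optCongestion c d ∧ SteinerRouting.optCongestion c d < ⊤ ∧
            ENNReal.ofReal (C' * Real.log k) * SteinerRouting.optCongestion c d ≤
              SteinerRouting.congestion c (S.serve d)) := by
  refine ⟨⟨288, by norm_num, fun V _ G c K hK => SteinerRouting.exists_competitive_scheme c hK⟩,
    1 / 12, by norm_num, fun k hk => SteinerRouting.exists_graph_forall_scheme hk⟩
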